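/- Let $m>0$ and $b\in(\mathbb R\setminus\{0\})\cup\{\infty\}$; put $B(p):=bp^2$ if $b\in\mathbb R\setminus\{0\}$ and $B(p):=\infty$ if $b=\infty$, with $\tfrac1\infty:=0$. Let $\theta$ be the Heaviside function. In $L^2(\mathbb R^2)$, with points $(q,p)$, let $L_0:=-i\,\tfrac pm\,\partial_q$ on its maximal domain $\{f\in L^2(\mathbb R^2): p\,\partial_q f\in L^2(\mathbb R^2)\}$ (distributional derivative), and for $f\in\operatorname{dom}(L_0)$ let $(\gamma f)(p):=f(0,p)$ be the trace on the line $q=0$. For $z\in\mathbb C\setminus\mathbb R$ set $$g_z(q,p):=\theta(qp\operatorname{Im}z)\,\operatorname{sgn}(\operatorname{Im}z)\,\frac{im}{|p|}\,e^{imzq/p},\qquad (G_z\phi)(q,p):=g_z(q,p)\,\phi(p),$$ $$(\Lambda^B_z\phi)(p):=\frac{\phi(p)}{\frac1{B(p)}-\operatorname{sgn}(\operatorname{Im}z)\frac{im}{2|p|}},\qquad (\Pi'\phi)(p):=\tfrac12\big(\phi(p)-\phi(-p)\big),$$ and let $L_B$ be the operator in $L^2(\mathbb R^2)$ with $$\operatorname{dom}(L_B)=\big\{f\in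 L^2(\mathbb R^2): f=f_z+G_z\Lambda^B_z\Pi'\gamma f_z,\ f_z\in\operatorname{dom}(L_0)\big\},\qquad (L_B-z)f=(L_0-z)f_z .$$ Then, whichever $z\in\mathbb C\setminus\mathbb R$ is used, $L_0$ and $L_B$ generate strongly continuous one-parameter unitary groups $e^{-itL_0}$ and $e^{-itL_B}$ on $L^2(\mathbb R^2)$ (with generators $-iL_0$ and $-iL_B$), and for all $f\in L^2(\mathbb R^2)$, all $t\in\mathbb R$ and almost every $(q,p)\in\mathbb R^2$, $$\big(e^{-itL_0}f\big)(q,p)=f\Big(q-\frac{pt}m,p\Big),$$ $$\big(e^{-itL_B}f\big)(q,p)=\big(e^{-itL_0}f\big)(q,p)-\frac{\theta(tqp)\,\theta\big(\frac{|pt|}m-|q|\big)}{1+\operatorname{sgn}(t)\,\frac{2i|p|}{mB(p)}}\,\big(e^{-itL_0}f_{odd}\big)(q,p),$$ where $f_{odd}(q,p):=f(q,p)-f(-q,-p)$. -/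

import Mathlib

open MeasureTheory Filter Topology
open scoped ContDiff

noncomputable section

/-- The Hilbert space `L²(ℝ²)` of phase-space functions; a point of `ℝ × ℝ` is `(q, p)`. -/
abbrev PhaseL2 : Type := Lp ℂ 2 (volume : Measure (ℝ × ℝ))

/-- The Heaviside function. -/
def heaviside (x : ℝ) : ℝ := if 0 < x then 1 else 0

/-- `h = -i (p/m) ∂_q f` in the sense of distributions on `ℝ²`. -/
def IsWeakL0 (m : ℝ) (f h : ℝ × ℝ → ℂ) : Prop :=
  ∀ η : ℝ × ℝ → ℂ, ContDiff ℝ ∞ η → HasCompactSupport η →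
    ∫ x, h x * η x = ∫ x, f x * (Complex.I * ((x.2 / m : ℝ) : ℂ) * fderiv ℝ η x (1, 0))

theorem integrable_L2_mul (f : PhaseL2) {χ : ℝ × ℝ → ℂ} (hχ : Continuous χ)
    (hs : HasCompactSupport χ) : Integrable (fun x => f x * χ x) :=
  (Lp.memLp f).integrable_mul (q := 2) (hχ.memLp_of_hasCompactSupport hs)

theorem integrable_L2_mul_deriv (m : ℝ) (f : PhaseL2) {η : ℝ × ℝ → ℂ} (hη : ContDiff ℝ ∞ η)
    (hs : HasCompactSupport η) :
    Integrable (fun x => f x * (Complex.I * ((x.2 / m : ℝ) : ℂ) * fderiv ℝ η x (1, 0))) := by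
  have hc : Continuous fun x => fderiv ℝ η x (1, 0) :=
    (hη.continuous_fderiv (by simp)).clm_apply continuous_const
  refine integrable_L2_mul f (by fun_prop) ?_
  exact (hs.fderiv_apply ℝ (1, 0)).mul_left

/-- The graph of `L₀ = -i (p/m) ∂_q` on its maximal domain in `L²(ℝ²)`. -/
def graphL0 (m : ℝ) : Submodule ℂ (PhaseL2 × PhaseL2) where
  carrier := {u | IsWeakL0 m u.1 u.2}
  zero_mem' := by
    intro η hη hs
    have h0 := Lp.coeFn_zero ℂ 2 (volume : Measure (ℝ × ℝ))
    have e1 : ∫ x, (0 : PhaseL2 × PhaseL2).2 x * η x = 0 := by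
      refine integral_eq_zero_of_ae ?_
      filter_upwards [h0] with x hx
      simp only [Prod.snd_zero, hx, Pi.zero_apply, zero_mul]
    have e2 : ∫ x, (0 : PhaseL2 × PhaseL2).1 x *
        (Complex.I * ((x.2 / m : ℝ) : ℂ) * fderiv ℝ η x (1, 0)) = 0 := by
      refine integral_eq_zero_of_ae ?_
      filter_upwards [h0] with x hx
      simp only [Prod.fst_zero, hx, Pi.zero_apply, zero_mul]
    rw [e1, e2]
  add_mem' := by
    intro u v hu hv η hη hs
    have e1 : ∫ x, (u + v).2 x * η x = ∫ x, (u.2 x * η x + v.2 x * η x) := by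
      refine integral_congr_ae ?_
      filter_upwards [Lp.coeFn_add u.2 v.2] with x hx
      simp only [Prod.snd_add, hx, Pi.add_apply, add_mul]
    have e2 : ∫ x, (u + v).1 x * (Complex.I * ((x.2 / m : ℝ) : ℂ) * fderiv ℝ η x (1, 0)) =
        ∫ x, (u.1 x * (Complex.I * ((x.2 / m : ℝ) : ℂ) * fderiv ℝ η x (1, 0)) +
          v.1 x * (Complex.I * ((x.2 / m : ℝ) : ℂ) * fderiv ℝ η x (1, 0))) := by
      refine integral_congr_ae ?_
      filter_upwards [Lp.coeFn_add u.1 v.1] with x hx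
      simp only [Prod.fst_add, hx, Pi.add_apply, add_mul]
    rw [e1, e2, integral_add (integrable_L2_mul _ hη.continuous hs)
      (integrable_L2_mul _ hη.continuous hs), integral_add (integrable_L2_mul_deriv m _ hη hs)
      (integrable_L2_mul_deriv m _ hη hs), hu η hη hs, hv η hη hs]
  smul_mem' := by
    intro c u hu η hη hs
    have e1 : ∫ x, (c • u).2 x * η x = ∫ x, c * (u.2 x * η x) := by
      refine integral_congr_ae ?_
      filter_upwards [Lp.coeFn_smul c u.2] with x hx
      simp only [Prod.smul_snd, hx, Pi.smul_apply, smul_eq_mul, mul_assoc]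
    have e2 : ∫ x, (c • u).1 x * (Complex.I * ((x.2 / m : ℝ) : ℂ) * fderiv ℝ η x (1, 0)) =
        ∫ x, c * (u.1 x * (Complex.I * ((x.2 / m : ℝ) : ℂ) * fderiv ℝ η x (1, 0))) := by
      refine integral_congr_ae ?_
      filter_upwards [Lp.coeFn_smul c u.1] with x hx
      simp only [Prod.smul_fst, hx, Pi.smul_apply, smul_eq_mul, mul_assoc]
    rw [e1, e2, integral_const_mul, integral_const_mul, hu η hη hs]

theorem graphL0_single_valued (m : ℝ) (u : PhaseL2 × PhaseL2) (hu : u ∈ graphL0 m)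
    (h0 : u.1 = 0) : u.2 = 0 := by
  rw [Lp.eq_zero_iff_ae_eq_zero]
  refine ae_eq_zero_of_integral_contDiff_smul_eq_zero
    ((Lp.memLp u.2).locallyIntegrable (by norm_num)) ?_
  intro g hg hs
  have h := hu (fun x => (g x : ℂ)) (Complex.ofRealCLM.contDiff.comp hg)
    (hs.comp_left (g := fun r : ℝ => (r : ℂ)) (by simp))
  have e : ∫ x, u.1 x * (Complex.I * ((x.2 / m : ℝ) : ℂ) *
      fderiv ℝ (fun x => (g x : ℂ)) x (1, 0)) = 0 := by
    refine integral_eq_zero_of_ae ?_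
    rw [h0]
    filter_upwards [Lp.coeFn_zero ℂ 2 (volume : Measure (ℝ × ℝ))] with x hx
    simp only [hx, Pi.zero_apply, zero_mul]
  rw [← h.trans e]
  refine integral_congr_ae (ae_of_all _ fun x => ?_)
  simp [mul_comm]

/-- The free Liouville operator `L₀ = -i (p/m) ∂_q` with its maximal domain. -/
def L0 (m : ℝ) : PhaseL2 →ₗ.[ℂ] PhaseL2 := (graphL0 m).toLinearPMap

theorem L0_graph (m : ℝ) : (L0 m).graph = graphL0 m :=
  Submodule.toLinearPMap_graph_eq _ (graphL0_single_valued m)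

/-- `φ = γ f`, the trace `(γ f)(p) = f(0, p)`: the class `f` has a representative which for almost
every `p` is continuous in `q`, and `φ(p)` is the value of that representative at `q = 0`. Such a
representative exists for `f ∈ dom L₀` (where `f(·, p) ∈ H¹(ℝ)` for almost every `p`), and its
value at `q = 0` is unique up to null sets of `p`. -/
def IsTrace (f : ℝ × ℝ → ℂ) (φ : ℝ → ℂ) : Prop :=
  ∃ F : ℝ × ℝ → ℂ, f =ᵐ[volume] F ∧ (∀ᵐ p : ℝ, Continuous fun q => F (q, p)) ∧
    ∀ᵐ p : ℝ, φ p = F (0, p)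

/-- The kernel `g_z(q, p)` of the free resolvent `(L₀ - z)⁻¹`. -/
def gKer (m : ℝ) (z : ℂ) (x : ℝ × ℝ) : ℂ :=
  (heaviside (x.1 * x.2 * z.im) : ℂ) * (Real.sign z.im : ℂ) * (Complex.I * m / |x.2|) *
    Complex.exp (Complex.I * m * z * x.1 / x.2)

/-- `(G_z φ)(q, p) = g_z(q, p) φ(p)`. -/
def Gop (m : ℝ) (z : ℂ) (φ : ℝ → ℂ) (x : ℝ × ℝ) : ℂ := gKer m z x * φ x.2

/-- The function `B : ℝ → ℝ ∪ {∞}`, `B(p) = b p²` for real `b` and `B(p) = ∞` for `b = ∞`. -/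
def Bfun (b : OnePoint ℝ) (p : ℝ) : OnePoint ℝ :=
  b.elim OnePoint.infty fun r => ((r * p ^ 2 : ℝ) : OnePoint ℝ)

/-- The reciprocal on `ℝ ∪ {∞}`, with `1/∞ = 0`. -/
def recip (a : OnePoint ℝ) : ℝ := a.elim 0 fun r => r⁻¹

/-- `(Λ_z^B φ)(p) = φ(p) / (1/B(p) - sgn(Im z) i m / (2|p|))`. -/
def Lam (m : ℝ) (b : OnePoint ℝ) (z : ℂ) (φ : ℝ → ℂ) (p : ℝ) : ℂ :=
  φ p / ((recip (Bfun b p) : ℂ) - (Real.sign z.im : ℂ) * (Complex.I * m / (2 * |p|)))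

/-- The projector `Π'` onto odd functions of `p`. -/
def oddProj (φ : ℝ → ℂ) (p : ℝ) : ℂ := (1 / 2) * (φ p - φ (-p))

/-- The graph of `L_B`: the pairs `(f, h)` with `f = f_z + G_z Λ_z^B Π' γ f_z`, `f_z ∈ dom L₀`,
and `h - z f = (L₀ - z) f_z`. -/
def graphLB (m : ℝ) (b : OnePoint ℝ) (z : ℂ) : Submodule ℂ (PhaseL2 × PhaseL2) where
  carrier := {u | ∃ (fz : (L0 m).domain) (φ : ℝ → ℂ), IsTrace (fz : PhaseL2) φ ∧
    (u.1 =ᵐ[volume] fun x => (fz : PhaseL2) x + Gop m z (Lam m b z (oddProj φ)) x) ∧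
    u.2 - z • u.1 = L0 m fz - z • (fz : PhaseL2)}
  zero_mem' := by
    have h0 := Lp.coeFn_zero ℂ 2 (volume : Measure (ℝ × ℝ))
    refine ⟨0, 0, ⟨0, by simpa using h0, ?_, ?_⟩, ?_, by simp⟩
    · exact ae_of_all _ fun p => continuous_const
    · exact ae_of_all _ fun p => rfl
    · filter_upwards with x
      simp [Gop, Lam, oddProj]
  add_mem' := by
    rintro u v ⟨f, φ, ⟨F, hF1, hF2, hF3⟩, hu, hu'⟩ ⟨g, ψ, ⟨G, hG1, hG2, hG3⟩, hv, hv'⟩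
    refine ⟨f + g, φ + ψ, ⟨F + G, ?_, ?_, ?_⟩, ?_, ?_⟩
    · exact (Lp.coeFn_add _ _).trans (hF1.add hG1)
    · filter_upwards [hF2, hG2] with p h1 h2 using h1.add h2
    · filter_upwards [hF3, hG3] with p h1 h2
      simp [h1, h2]
    · filter_upwards [hu, hv, Lp.coeFn_add u.1 v.1, Lp.coeFn_add (f : PhaseL2) g] with x h1 h2 h3 h4
      simp only [Prod.fst_add, Submodule.coe_add, h3, h4, Pi.add_apply, h1, h2, Gop, Lam, oddProj]
      ring
    · rw [LinearPMap.map_add, Submodule.coe_add, Prod.snd_add, Prod.fst_add, smul_add, smul_add,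
        add_sub_add_comm, add_sub_add_comm, hu', hv']
  smul_mem' := by
    rintro c u ⟨f, φ, ⟨F, hF1, hF2, hF3⟩, hu, hu'⟩
    refine ⟨c • f, c • φ, ⟨c • F, ?_, ?_, ?_⟩, ?_, ?_⟩
    · exact (Lp.coeFn_smul _ _).trans (hF1.const_smul c)
    · filter_upwards [hF2] with p h1 using h1.const_smul c
    · filter_upwards [hF3] with p h1
      simp [h1]
    · filter_upwards [hu, Lp.coeFn_smul c u.1, Lp.coeFn_smul c (f : PhaseL2)] with x h1 h3 h4
      simp only [Prod.smul_fst, Submodule.coe_smul, h3, h4, Pi.smul_apply, h1, Gop, Lam, oddProj,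
        smul_eq_mul]
      ring
    · rw [LinearPMap.map_smul, Submodule.coe_smul, Prod.smul_snd, Prod.smul_fst, smul_comm z c,
        smul_comm z c, ← smul_sub, ← smul_sub, hu']

theorem eq_zero_of_continuous_jump {F : ℝ → ℂ} (hF : Continuous F) {m p : ℝ} (hm : m ≠ 0)
    (hp : p ≠ 0) {z : ℂ} (hz : z.im ≠ 0) {c : ℂ} (h : ∀ᵐ q : ℝ, 0 = F q + gKer m z (q, p) * c) :
    c = 0 := by
  have hs : p * z.im ≠ 0 := mul_ne_zero hp hz
  set E : ℝ → ℂ := fun q => (Real.sign z.im : ℂ) * (Complex.I * m / |p|) *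
    Complex.exp (Complex.I * m * z * q / p) * c with hE
  have hEc : Continuous E := by fun_prop
  have key : ∀ s : Set ℝ, IsOpen s → (0 : ℝ) ∈ closure s → ∀ G : ℝ → ℂ, Continuous G →
      (∀ q ∈ s, gKer m z (q, p) * c = G q) → F 0 + G 0 = 0 := by
    intro s hs h0 G hG hsG
    have h1 : (fun q => F q + G q) =ᵐ[volume.restrict s] fun _ => 0 := by
      filter_upwards [ae_restrict_of_ae h, ae_restrict_mem hs.measurableSet] with q h1 h2
      rw [← hsG q h2, ← h1]
    have h2 := Measure.eqOn_open_of_ae_eq h1 hs (by fun_prop) (by fun_prop)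
    exact h2.closure (by fun_prop) (by fun_prop) h0
  have hpos : ∀ q, 0 < q * p * z.im → gKer m z (q, p) * c = E q := by
    intro q hq
    simp [gKer, heaviside, hq, hE]
  have hneg : ∀ q, q * p * z.im < 0 → gKer m z (q, p) * c = 0 := by
    intro q hq
    simp [gKer, heaviside, not_lt.mpr hq.le]
  have hIoi : (0 : ℝ) ∈ closure (Set.Ioi (0 : ℝ)) := by simp
  have hIio : (0 : ℝ) ∈ closure (Set.Iio (0 : ℝ)) := by simp
  have hfin : F 0 + E 0 = 0 ∧ F 0 + 0 = 0 := by
    rcases lt_or_gt_of_ne hs with hs | hs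
    · refine ⟨key _ isOpen_Iio hIio E hEc fun q hq => hpos q ?_,
        key _ isOpen_Ioi hIoi (fun _ => 0) continuous_const fun q hq => hneg q ?_⟩
      · rw [mul_assoc]
        exact mul_pos_of_neg_of_neg hq hs
      · rw [mul_assoc]
        exact mul_neg_of_pos_of_neg hq hs
    · refine ⟨key _ isOpen_Ioi hIoi E hEc fun q hq => hpos q ?_,
        key _ isOpen_Iio hIio (fun _ => 0) continuous_const fun q hq => hneg q ?_⟩
      · rw [mul_assoc]
        exact mul_pos hq hs
      · rw [mul_assoc]
        exact mul_neg_of_neg_of_pos hq hs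
  have hE0 : E 0 = 0 := by
    have h1 := hfin.1
    have h2 := hfin.2
    rw [add_zero] at h2
    rwa [h2, zero_add] at h1
  simpa [hE, hm, hp, Real.sign_eq_zero_iff, hz] using hE0

theorem graphLB_single_valued {m : ℝ} (hm : m ≠ 0) (b : OnePoint ℝ) {z : ℂ} (hz : z.im ≠ 0)
    (u : PhaseL2 × PhaseL2) (hu : u ∈ graphLB m b z) (h0 : u.1 = 0) : u.2 = 0 := by
  obtain ⟨f, φ, ⟨F, hF1, hF2, -⟩, hu, hu'⟩ := hu
  set ψ := Lam m b z (oddProj φ) with hψ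
  have h1 : ∀ᵐ x : ℝ × ℝ, 0 = F x + gKer m z x * ψ x.2 := by
    rw [h0] at hu
    filter_upwards [hu, hF1, Lp.coeFn_zero ℂ 2 (volume : Measure (ℝ × ℝ))] with x h1 h2 h3
    rw [← h2]
    exact (h1.symm.trans h3).symm
  have h2 : ∀ᵐ p : ℝ, ∀ᵐ q : ℝ, 0 = F (q, p) + gKer m z (q, p) * ψ p := by
    have := (Measure.measurePreserving_swap (μ := (volume : Measure ℝ))
      (ν := (volume : Measure ℝ))).quasiMeasurePreserving.ae h1
    exact Measure.ae_ae_of_ae_prod this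
  have h3 : ∀ᵐ p : ℝ, ψ p = 0 := by
    filter_upwards [h2, hF2, Measure.ae_ne volume (0 : ℝ)] with p h2 h3 h4
    exact eq_zero_of_continuous_jump h3 hm h4 hz h2
  have h4 : (f : PhaseL2) = 0 := by
    rw [Lp.eq_zero_iff_ae_eq_zero]
    have h5 : ∀ᵐ x : ℝ × ℝ, ψ x.2 = 0 := Measure.quasiMeasurePreserving_snd.ae h3
    filter_upwards [h1, h5, hF1] with x h1 h5 h6
    rw [h6, Pi.zero_apply, h1, h5, mul_zero, add_zero]
  have h5 : f = 0 := Subtype.ext h4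
  rw [h5, h0] at hu'
  simpa using hu'

/-- The operator `L_B` with `dom L_B = {f | f = f_z + G_z Λ_z^B Π' γ f_z, f_z ∈ dom L₀}` and
`(L_B - z) f = (L₀ - z) f_z`. -/
def LB (m : ℝ) (b : OnePoint ℝ) (z : ℂ) : PhaseL2 →ₗ.[ℂ] PhaseL2 := (graphLB m b z).toLinearPMap

theorem LB_graph {m : ℝ} (hm : m ≠ 0) (b : OnePoint ℝ) {z : ℂ} (hz : z.im ≠ 0) :
    (LB m b z).graph = graphLB m b z :=
  Submodule.toLinearPMap_graph_eq _ (graphLB_single_valued hm b hz)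

/-- `U t = e^{-itA}`: `U` is a strongly continuous one-parameter unitary group whose generator
(the strong derivative at `t = 0`, with its full domain of existence) is `-iA`. -/
structure IsUnitaryGroup (A : PhaseL2 →ₗ.[ℂ] PhaseL2) (U : ℝ → PhaseL2 ≃ₗᵢ[ℂ] PhaseL2) : Prop where
  map_zero : ∀ f, U 0 f = f
  map_add : ∀ s t f, U (s + t) f = U s (U t f)
  continuous : ∀ f, Continuous fun t => U t f
  generator : ∀ f h, (f, h) ∈ A.graph ↔
    Tendsto (fun t : ℝ => (t : ℂ)⁻¹ • (U t f - f)) (𝓝[≠] 0) (𝓝 (-Complex.I • h))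

/-- The free translation `f(q - p t / m, p)`. -/
def freeFlow (m t : ℝ) (f : ℝ × ℝ → ℂ) (x : ℝ × ℝ) : ℂ := f (x.1 - x.2 * t / m, x.2)

/-- `f_odd(q, p) = f(q, p) - f(-q, -p)`. -/
def fOdd (f : ℝ × ℝ → ℂ) (x : ℝ × ℝ) : ℂ := f x - f (-x.1, -x.2)

end

/-!
`e^{-itL_B}` is `W⁻¹ e^{-itL₀} W`, where the unitary `W` leaves the even part of a function on phase
space unchanged and multiplies its odd part by an even unimodular phase: `1` on the incoming half
`q p < 0` of phase space and `-(1 + iκ) / (1 - iκ)`, `κ(p) = 2|p| / (m B(p))`, on the outgoing half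
`q p > 0`. A trajectory of the free motion keeps its phase until it crosses the line `q = 0`, so
the conjugation changes the free evolution of the odd part exactly at the points reached after a
crossing.

The generator of a unitary group is determined by its resolvent, which is a Laplace transform of the
group. For the conjugated group, the part of this integral lying beyond the crossing time is the
value of the free resolvent on the line `q = 0` times an explicit exponential: this is the
Kreĭn-type formula by which `L_B` is defined.
-/

noncomputable section

/-! ### Groups of isometries and their generators -/

/-- A strongly continuous one-parameter group of linear isometries, without reference to a
generator. -/
structure IsIsometricFlow {E : Type*} [NormedAddCommGroup E] [NormedSpace ℂ E]
    (U : ℝ → E ≃ₗᵢ[ℂ] E) : Prop where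
  map_zero : ∀ f, U 0 f = f
  map_add : ∀ s t f, U (s + t) f = U s (U t f)
  continuous : ∀ f, Continuous fun t => U t f

theorem IsUnitaryGroup.isIsometricFlow {A : PhaseL2 →ₗ.[ℂ] PhaseL2}
    {U : ℝ → PhaseL2 ≃ₗᵢ[ℂ] PhaseL2} (h : IsUnitaryGroup A U) : IsIsometricFlow U :=
  ⟨h.map_zero, h.map_add, h.continuous⟩

namespace IsIsometricFlow

variable {E : Type*} [NormedAddCommGroup E] [NormedSpace ℂ E] {U V : ℝ → E ≃ₗᵢ[ℂ] E}

theorem tendsto_slope_iff_hasDerivAt (hU : IsIsometricFlow U) {f g : E} :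
    Tendsto (fun t : ℝ => (t : ℂ)⁻¹ • (U t f - f)) (𝓝[≠] 0) (𝓝 g) ↔
      HasDerivAt (fun t => U t f) g 0 := by
  rw [hasDerivAt_iff_tendsto_slope_zero]
  refine tendsto_congr fun t => ?_
  rw [zero_add, hU.map_zero, ← Complex.coe_smul, Complex.ofReal_inv]

theorem hasDerivAt (hU : IsIsometricFlow U) {f g : E} (h : HasDerivAt (fun t => U t f) g 0)
    (t : ℝ) : HasDerivAt (fun t => U t f) (U t g) t := by
  have shifted : HasDerivAt (fun s => U (s - t) f) g t :=
    HasDerivAt.comp_sub_const t t (by simpa using h)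
  have := ((U t).toContinuousLinearEquiv.toContinuousLinearMap.restrictScalars
    ℝ).hasFDerivAt.comp_hasDerivAt t shifted
  refine this.congr_of_eventuallyEq (Eventually.of_forall fun s => ?_)
  simp [← hU.map_add]

theorem hasDerivAt_map (hU : IsIsometricFlow U) {f g : E} (h : HasDerivAt (fun t => U t f) g 0)
    (t : ℝ) : HasDerivAt (fun s => U s (U t f)) (U t g) 0 := by
  have := HasDerivAt.comp_add_const 0 t (by simpa using hU.hasDerivAt h t)
  simpa only [hU.map_add] using this

theorem comp_mul_left (hU : IsIsometricFlow U) (σ : ℝ) :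
    IsIsometricFlow fun t => U (σ * t) where
  map_zero f := by rw [mul_zero, hU.map_zero]
  map_add s t f := by rw [mul_add, hU.map_add]
  continuous f := (hU.continuous f).comp (continuous_const_mul σ)

theorem conj (hU : IsIsometricFlow U) {F : Type*} [NormedAddCommGroup F] [NormedSpace ℂ F]
    (W : F ≃ₗᵢ[ℂ] E) : IsIsometricFlow fun t => (W.trans (U t)).trans W.symm where
  map_zero f := by simp [hU.map_zero]
  map_add s t f := by simp [hU.map_add]
  continuous f := W.symm.continuous.comp (hU.continuous (W f))

variable [CompleteSpace E]

theorem hasDerivAt_integral (hU : IsIsometricFlow U) (f : E) (a : ℝ) :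
    HasDerivAt (fun r => U r (∫ s in (0 : ℝ)..a, U s f)) (U a f - f) 0 := by
  have hint : ∀ a b, IntervalIntegrable (fun s => U s f) volume a b :=
    (hU.continuous f).intervalIntegrable
  have shift : ∀ r, U r (∫ s in (0 : ℝ)..a, U s f) =
      (∫ s in (0 : ℝ)..(a + r), U s f) - ∫ s in (0 : ℝ)..r, U s f := by
    intro r
    calc U r (∫ s in (0 : ℝ)..a, U s f) = ∫ s in (0 : ℝ)..a, U r (U s f) :=
          ((U r).toContinuousLinearEquiv.toContinuousLinearMap.intervalIntegral_comp_comm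
            (hint 0 a)).symm
      _ = ∫ s in r..(a + r), U s f := by
          simp only [← hU.map_add]
          rw [intervalIntegral.integral_comp_add_left (fun s => U s f), add_zero, add_comm]
      _ = _ := (intervalIntegral.integral_interval_sub_left (hint _ _) (hint _ _)).symm
  have primitive : ∀ x, HasDerivAt (fun r => ∫ s in (0 : ℝ)..r, U s f) (U x f) x := fun x =>
    ((hU.continuous f).integral_hasStrictDerivAt 0 x).hasDerivAt
  have at_zero := primitive 0
  rw [hU.map_zero] at at_zero
  simp only [shift]
  exact (HasDerivAt.comp_const_add a 0 (by simpa using primitive a)).sub at_zero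

theorem dense_differentiable (hU : IsIsometricFlow U) :
    Dense {f : E | ∃ g, HasDerivAt (fun t => U t f) g 0} := by
  intro f
  have primitive : HasDerivAt (fun r => ∫ s in (0 : ℝ)..r, U s f) f 0 := by
    simpa [hU.map_zero] using ((hU.continuous f).integral_hasStrictDerivAt 0 0).hasDerivAt
  rw [hasDerivAt_iff_tendsto_slope_zero] at primitive
  refine mem_closure_of_tendsto primitive (Eventually.of_forall fun t => ?_)
  refine ⟨t⁻¹ • (U t f - f), ((hU.hasDerivAt_integral f t).const_smul
    t⁻¹).congr_of_eventuallyEq (Eventually.of_forall fun r => ?_)⟩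
  simp only [zero_add, intervalIntegral.integral_same, sub_zero, ← Complex.coe_smul, map_smul,
    Pi.smul_apply]

theorem unique (hU : IsIsometricFlow U) (hV : IsIsometricFlow V)
    (hUV : ∀ f g, HasDerivAt (fun t => U t f) g 0 → HasDerivAt (fun t => V t f) g 0) : U = V := by
  have inv : ∀ s f, V s (V (-s) f) = f := fun s f => by
    rw [← hV.map_add, add_neg_cancel, hV.map_zero]
  funext t
  refine LinearIsometryEquiv.ext fun f => congr_fun (Continuous.ext_on hU.dense_differentiable
    (U t).continuous (V t).continuous ?_) f
  rintro f ⟨g, hg⟩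
  -- `V (-s) (U s f)` is constant: its increments have the norm of `U r (U s f) - V r (U s f)`,
  -- a difference of two orbits of `U s f` with the same velocity at `r = 0`.
  have stationary : ∀ s, HasDerivAt (fun s => V (-s) (U s f)) 0 s := by
    intro s
    have same := hU.hasDerivAt_map hg s
    have := same.sub (hUV _ _ same)
    rw [sub_self, hasDerivAt_iff_isLittleO_nhds_zero] at this
    rw [hasDerivAt_iff_isLittleO_nhds_zero]
    refine (this.norm_left.congr_left fun r => ?_).of_norm_left
    calc ‖(fun r => U r (U s f) - V r (U s f)) (0 + r) -
          (fun r => U r (U s f) - V r (U s f)) 0 - r • (0 : E)‖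
        = ‖U r (U s f) - V r (U s f)‖ := by simp [hU.map_zero, hV.map_zero]
      _ = ‖V (-(s + r)) (U r (U s f) - V r (U s f))‖ := ((V _).norm_map _).symm
      _ = ‖V (-(s + r)) (U (s + r) f) - V (-s) (U s f) - r • (0 : E)‖ := by
        rw [map_sub, ← hU.map_add, ← hV.map_add, smul_zero, sub_zero, add_comm r s,
          show -(s + r) + r = -s by ring]
  have const := is_const_of_deriv_eq_zero (fun s => (stationary s).differentiableAt)
    (fun s => (stationary s).deriv) t 0
  simp only [neg_zero, hU.map_zero, hV.map_zero] at const
  rw [← inv t (U t f), const]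

theorem hasDerivAt_of_weak (hU : IsIsometricFlow U) {ι : Type*} (l : ι → E →L[ℂ] ℂ)
    (separating : ∀ f, (∀ i, l i f = 0) → f = 0) {f g : E}
    (h : ∀ i t, HasDerivAt (fun t => l i (U t f)) (l i (U t g)) t) :
    HasDerivAt (fun t => U t f) g 0 := by
  have integral_eq : ∀ t, U t f = f + ∫ s in (0 : ℝ)..t, U s g := by
    intro t
    rw [← sub_eq_zero]
    refine separating _ fun i => ?_
    have ftc := intervalIntegral.integral_eq_sub_of_hasDerivAt (fun s _ => h i s)
      (((l i).continuous.comp (hU.continuous g)).intervalIntegrable 0 t)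
    have comm := (l i).intervalIntegral_comp_comm (μ := volume)
      ((hU.continuous g).intervalIntegrable 0 t)
    rw [map_sub, _root_.map_add, ← comm, ftc, hU.map_zero]
    ring
  have primitive := ((hU.continuous g).integral_hasStrictDerivAt 0 0).hasDerivAt.const_add f
  rw [hU.map_zero] at primitive
  exact primitive.congr_of_eventuallyEq (Eventually.of_forall integral_eq)

theorem hasDerivAt_iff_of_weak (hU : IsIsometricFlow U) {ι : Type*} (l : ι → E →L[ℂ] ℂ)
    (l' : ι → E → ℂ) (separating : ∀ f, (∀ i, l i f = 0) → f = 0)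
    (hl' : ∀ i f, HasDerivAt (fun t => l i (U t f)) (l' i f) 0)
    (invariant : ∀ i t, ∃ j, ∀ f, l i (U t f) = l j f) (f g : E) :
    HasDerivAt (fun t => U t f) g 0 ↔ ∀ i, l i g = l' i f := by
  constructor
  · intro h i
    exact (((l i).restrictScalars ℝ).hasFDerivAt.comp_hasDerivAt 0 h).unique (hl' i f)
  · intro h
    refine hU.hasDerivAt_of_weak l separating fun i t => ?_
    obtain ⟨j, hj⟩ := invariant i t
    have shift : ∀ s, l i (U s f) = l j (U (s - t) f) := fun s => by
      rw [← hj, ← hU.map_add, add_sub_cancel]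
    simp only [shift, hj, h]
    exact HasDerivAt.comp_sub_const (f := fun s => l j (U s f)) t t (by simpa using hl' j f)

end IsIsometricFlow

/-! ### Resolvents as Laplace transforms -/

section Laplace

variable {E : Type*} [NormedAddCommGroup E] [NormedSpace ℂ E] {U : ℝ → E ≃ₗᵢ[ℂ] E}

/-- The Laplace transform `∫₀^∞ e^{ws} U(s) g ds` of an orbit; it converges for `Re w < 0`. -/
def laplaceTransform (U : ℝ → E ≃ₗᵢ[ℂ] E) (w : ℂ) (g : E) : E :=
  ∫ s in Set.Ioi (0 : ℝ), Complex.exp (w * s) • U s g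

/-- The resolvent `(A - z)⁻¹ = iσ ∫₀^∞ e^{iσzs} U(σs) ds`, `σ = sgn (Im z)`, of the operator `A`
with `U t = e^{-itA}`. -/
def laplaceResolvent (U : ℝ → E ≃ₗᵢ[ℂ] E) (z : ℂ) (g : E) : E :=
  (Complex.I * (Real.sign z.im : ℂ)) •
    laplaceTransform (fun s => U (Real.sign z.im * s)) (Complex.I * (Real.sign z.im : ℂ) * z) g

theorem re_I_mul_sign_mul_neg {z : ℂ} (hz : z.im ≠ 0) :
    (Complex.I * (Real.sign z.im : ℂ) * z).re < 0 := by
  rcases hz.lt_or_gt with h | h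
  · simp [Real.sign_of_neg h, h]
  · simp [Real.sign_of_pos h, h]

theorem sign_mul_sign_self {x : ℝ} (hx : x ≠ 0) : Real.sign x * Real.sign x = 1 := by
  rcases Real.sign_apply_eq_of_ne_zero x hx with h | h <;> simp [h]

theorem hasDerivAt_comp_mul_left_iff {F : ℝ → E} {σ : ℝ} (hσ : σ ≠ 0) {g : E} :
    HasDerivAt (fun t => F (σ * t)) (σ • g) 0 ↔ HasDerivAt F g 0 := by
  constructor
  · intro h
    have := HasDerivAt.scomp (h := fun t => σ⁻¹ * t) 0
      (by simpa using h) ((hasDerivAt_id (0 : ℝ)).const_mul σ⁻¹)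
    simpa [Function.comp_def, hσ, smul_smul] using this
  · intro h
    exact HasDerivAt.scomp (h := fun t => σ * t) 0 (by simpa using h)
      (by simpa using (hasDerivAt_id (0 : ℝ)).const_mul σ)

theorem hasDerivAt_exp_mul (w : ℂ) (s : ℝ) :
    HasDerivAt (fun s : ℝ => Complex.exp (w * s)) (w * Complex.exp (w * s)) s := by
  have linear : HasDerivAt (fun s : ℝ => w * (s : ℂ)) w s := by
    simpa using (Complex.ofRealCLM.hasDerivAt (x := s)).const_mul w
  simpa [mul_comm] using linear.cexp

theorem laplaceTransform_smul (w c : ℂ) (g : E) :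
    laplaceTransform U w (c • g) = c • laplaceTransform U w g := by
  simp only [laplaceTransform, map_smul, ← integral_smul, smul_comm c]

namespace IsIsometricFlow

theorem continuous_exp_smul (hU : IsIsometricFlow U) (w : ℂ) (g : E) :
    Continuous fun s : ℝ => Complex.exp (w * s) • U s g :=
  (by fun_prop : Continuous fun s : ℝ => Complex.exp (w * s)).smul (hU.continuous g)

theorem integrableOn_exp_smul (hU : IsIsometricFlow U) {w : ℂ} (hw : w.re < 0) (g : E) (a : ℝ) :
    IntegrableOn (fun s : ℝ => Complex.exp (w * s) • U s g) (Set.Ioi a) := by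
  refine ((integrableOn_exp_mul_complex_Ioi hw a).norm.mul_const ‖g‖).mono'
    (hU.continuous_exp_smul w g).aestronglyMeasurable (ae_of_all _ fun s => ?_)
  rw [norm_smul, LinearIsometryEquiv.norm_map]

variable [CompleteSpace E]

theorem laplaceTransform_of_hasDerivAt (hU : IsIsometricFlow U) {w : ℂ} (hw : w.re < 0) {f g : E}
    (h : HasDerivAt (fun t => U t f) g 0) : laplaceTransform U w (g + w • f) = -f := by
  have deriv : ∀ s ∈ Set.Ici (0 : ℝ), HasDerivAt (fun s : ℝ => Complex.exp (w * s) • U s f)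
      (Complex.exp (w * s) • U s (g + w • f)) s := by
    intro s _
    refine ((hasDerivAt_exp_mul w s).smul (hU.hasDerivAt h s)).congr_deriv ?_
    rw [_root_.map_add, map_smul, smul_add, smul_smul, mul_comm w (Complex.exp _)]
  have decay : Tendsto (fun s : ℝ => Complex.exp (w * s) • U s f) atTop (𝓝 0) := by
    rw [tendsto_zero_iff_norm_tendsto_zero]
    have : Tendsto (fun s : ℝ => Real.exp (w.re * s) * ‖f‖) atTop (𝓝 (0 * ‖f‖)) :=
      (Real.tendsto_exp_atBot.comp (tendsto_id.const_mul_atTop_of_neg hw)).mul_const ‖f‖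
    simpa [norm_smul, Complex.norm_exp] using this
  have ftc := integral_Ioi_of_hasDerivAt_of_tendsto' deriv
    (hU.integrableOn_exp_smul hw (g + w • f) 0) decay
  simpa [laplaceTransform, hU.map_zero] using ftc

theorem map_laplaceTransform (hU : IsIsometricFlow U) {w : ℂ} (hw : w.re < 0) (g : E) (t : ℝ) :
    U t (laplaceTransform U w g) = Complex.exp (-w * t) •
      (laplaceTransform U w g - ∫ s in (0 : ℝ)..t, Complex.exp (w * s) • U s g) := by
  have hint := hU.integrableOn_exp_smul hw g
  have shift : U t (laplaceTransform U w g) =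
      ∫ s in Set.Ioi t, Complex.exp (-w * t) • Complex.exp (w * s) • U s g := by
    have comm := (U t).toContinuousLinearEquiv.toContinuousLinearMap.integral_comp_comm (hint 0)
    have translate := (measurePreserving_add_right volume t).setIntegral_preimage_emb
      (measurableEmbedding_addRight t)
      (fun s : ℝ => Complex.exp (-w * t) • Complex.exp (w * s) • U s g) (Set.Ioi t)
    rw [Set.preimage_add_const_Ioi, sub_self] at translate
    refine comm.symm.trans (Eq.trans ?_ translate)
    refine setIntegral_congr_fun measurableSet_Ioi fun s _ => ?_
    simp only [ContinuousLinearEquiv.coe_coe, LinearIsometryEquiv.coe_toContinuousLinearEquiv,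
      map_smul, ← hU.map_add, smul_smul, ← Complex.exp_add, add_comm s t]
    congr 2
    push_cast
    ring
  rw [shift, integral_smul, laplaceTransform,
    ← intervalIntegral.integral_Ioi_sub_Ioi' (hint 0) (hint t), sub_sub_cancel]

theorem hasDerivAt_laplaceTransform (hU : IsIsometricFlow U) {w : ℂ} (hw : w.re < 0) (g : E) :
    HasDerivAt (fun t => U t (laplaceTransform U w g)) (-(w • laplaceTransform U w g + g)) 0 := by
  have primitive :
      HasDerivAt (fun t : ℝ => ∫ s in (0 : ℝ)..t, Complex.exp (w * s) • U s g) g 0 := by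
    simpa [hU.map_zero] using
      ((hU.continuous_exp_smul w g).integral_hasStrictDerivAt 0 0).hasDerivAt
  simp only [hU.map_laplaceTransform hw]
  refine ((hasDerivAt_exp_mul (-w) 0).smul
    (primitive.const_sub (laplaceTransform U w g))).congr_deriv ?_
  simp only [Complex.ofReal_zero, mul_zero, Complex.exp_zero, one_smul, mul_one, neg_smul,
    intervalIntegral.integral_same, sub_zero]
  abel

theorem hasDerivAt_iff_eq_laplaceTransform (hU : IsIsometricFlow U) {w : ℂ} (hw : w.re < 0)
    {f g : E} : HasDerivAt (fun t => U t f) g 0 ↔ f = -laplaceTransform U w (g + w • f) := by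
  constructor
  · intro h
    rw [hU.laplaceTransform_of_hasDerivAt hw h, neg_neg]
  · intro hf
    have deriv := hU.hasDerivAt_laplaceTransform hw (g + w • f)
    rw [← neg_eq_iff_eq_neg.mpr hf] at deriv
    have generator : -(-(w • -f + (g + w • f))) = g := by module
    simpa only [Pi.neg_def, map_neg, neg_neg, generator] using deriv.neg

theorem hasDerivAt_iff_eq_laplaceResolvent (hU : IsIsometricFlow U) {z : ℂ} (hz : z.im ≠ 0)
    {f h : E} : HasDerivAt (fun t => U t f) (-Complex.I • h) 0 ↔
      f = laplaceResolvent U z (h - z • f) := by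
  have hσ : Real.sign z.im ≠ 0 := left_ne_zero_of_mul_eq_one (sign_mul_sign_self hz)
  rw [← hasDerivAt_comp_mul_left_iff hσ,
    (hU.comp_mul_left (Real.sign z.im)).hasDerivAt_iff_eq_laplaceTransform
      (re_I_mul_sign_mul_neg hz)]
  have generator : Real.sign z.im • (-Complex.I • h) +
      (Complex.I * (Real.sign z.im : ℂ) * z) • f =
      -(Complex.I * (Real.sign z.im : ℂ)) • (h - z • f) := by
    rw [← Complex.coe_smul]
    module
  rw [generator, laplaceTransform_smul, neg_smul, neg_neg, laplaceResolvent]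

end IsIsometricFlow

theorem laplaceResolvent_conj {F : Type*} [NormedAddCommGroup F]
    [NormedSpace ℂ F] (W : F ≃ₗᵢ[ℂ] E) (z : ℂ) (g : F) :
    laplaceResolvent (fun t => (W.trans (U t)).trans W.symm) z g =
      W.symm (laplaceResolvent U z (W g)) := by
  have comm := W.symm.toContinuousLinearEquiv.integral_comp_comm
    (μ := volume.restrict (Set.Ioi (0 : ℝ))) (fun s : ℝ =>
      Complex.exp (Complex.I * (Real.sign z.im : ℂ) * z * s) • U (Real.sign z.im * s) (W g))
  simp only [LinearIsometryEquiv.coe_toContinuousLinearEquiv, map_smul] at comm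
  simp only [laplaceResolvent, laplaceTransform, map_smul, LinearIsometryEquiv.trans_apply, comm]

end Laplace

/-! ### The free group -/

section Koopman

variable {X E : Type*} [TopologicalSpace X] [MeasurableSpace X]
  [NormedAddCommGroup E] {μ : Measure X} {p : ENNReal}
  {ϕ : Flow ℝ X} (hϕ : ∀ t, MeasurePreserving (ϕ t) μ μ)

theorem compMeasurePreserving_flow_add (s t : ℝ) (f : Lp E p μ) :
    Lp.compMeasurePreserving (ϕ s) (hϕ s) (Lp.compMeasurePreserving (ϕ t) (hϕ t) f) =
      Lp.compMeasurePreserving (ϕ (s + t)) (hϕ (s + t)) f := by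
  have comp : ϕ t ∘ ϕ s = ϕ (s + t) := funext fun x => by
    rw [Function.comp_apply, ← Flow.map_add, add_comm]
  simp only [← Lp.compMeasurePreserving_comp_apply, comp]

theorem compMeasurePreserving_flow_zero (f : Lp E p μ) :
    Lp.compMeasurePreserving (ϕ 0) (hϕ 0) f = f := by
  have id : ϕ 0 = id := funext ϕ.map_zero_apply
  simp only [id, Lp.compMeasurePreserving_id_apply]

variable [NormedSpace ℂ E] [Fact (1 ≤ p)]

/-- The Koopman group `f ↦ f ∘ ϕ t` of a measure-preserving flow, acting on `L^p`. -/
def koopman (t : ℝ) : Lp E p μ ≃ₗᵢ[ℂ] Lp E p μ :=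
  LinearIsometryEquiv.ofSurjective (Lp.compMeasurePreservingₗᵢ ℂ (ϕ t) (hϕ t)) fun f =>
    ⟨Lp.compMeasurePreserving (ϕ (-t)) (hϕ (-t)) f, by
      change Lp.compMeasurePreserving _ _ (Lp.compMeasurePreserving _ _ f) = f
      simp only [compMeasurePreserving_flow_add, add_neg_cancel]
      exact compMeasurePreserving_flow_zero hϕ f⟩

theorem coeFn_koopman (t : ℝ) (f : Lp E p μ) : koopman hϕ t f =ᵐ[μ] f ∘ ϕ t :=
  Lp.coeFn_compMeasurePreserving f (hϕ t)

theorem isIsometricFlow_koopman [R1Space X] [BorelSpace X] [IsLocallyFiniteMeasure μ]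
    [μ.InnerRegularCompactLTTop] (hp : p ≠ ⊤) :
    IsIsometricFlow (koopman (E := E) (p := p) hϕ) where
  map_zero f := compMeasurePreserving_flow_zero hϕ f
  map_add s t f := (compMeasurePreserving_flow_add hϕ s t f).symm
  continuous f := Continuous.compMeasurePreservingLp (f := fun _ => f)
    (g := fun t => ⟨ϕ t, ϕ.continuous continuous_const continuous_id⟩)
    continuous_const (ContinuousMap.continuous_of_continuous_uncurry _ ϕ.cont') hϕ hp

end Koopman

/-- The free motion `(q, p) ↦ (q - p t / m, p)`, run backwards in time. -/
def shear (m : ℝ) : Flow ℝ (ℝ × ℝ) where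
  toFun t x := (x.1 - x.2 * t / m, x.2)
  cont' := by simp only [Function.uncurry_def]; fun_prop
  map_add' s t x := Prod.ext (by dsimp only; ring) rfl
  map_zero' x := by simp

theorem shear_apply (m t : ℝ) (x : ℝ × ℝ) : shear m t x = (x.1 - x.2 * t / m, x.2) := rfl

theorem contDiff_shear (m t : ℝ) : ContDiff ℝ ∞ (shear m t) :=
  (by fun_prop : ContDiff ℝ ∞ fun x : ℝ × ℝ => (x.1 - x.2 * t / m, x.2))

theorem measurePreserving_shear (m t : ℝ) : MeasurePreserving (shear m t) := by
  have fiberwise : MeasurePreserving (fun x : ℝ × ℝ => (x.1, x.2 - x.1 * t / m))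
      (volume.prod volume) (volume.prod volume) :=
    (MeasurePreserving.id volume).skew_product (g := fun p q => q - p * t / m) (by fun_prop)
      (ae_of_all _ fun p => (measurePreserving_sub_right volume (p * t / m)).map_eq)
  exact (Measure.measurePreserving_swap.comp fiberwise).comp Measure.measurePreserving_swap

/-- The free group `e^{-itL₀}` on phase space, `f ↦ f (q - p t / m, p)`. -/
abbrev freeGroup (m : ℝ) : ℝ → PhaseL2 ≃ₗᵢ[ℂ] PhaseL2 :=
  koopman (measurePreserving_shear m)

theorem isIsometricFlow_freeGroup (m : ℝ) : IsIsometricFlow (freeGroup m) :=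
  isIsometricFlow_koopman _ ENNReal.ofNat_ne_top

theorem coeFn_freeGroup (m t : ℝ) (f : PhaseL2) : freeGroup m t f =ᵐ[volume] freeFlow m t f :=
  coeFn_koopman _ t f

theorem integral_freeGroup_mul (m t : ℝ) (f : PhaseL2) (η : ℝ × ℝ → ℂ) :
    ∫ x, freeGroup m t f x * η x = ∫ x, f x * η (shear m (-t) x) := by
  have cov := (measurePreserving_shear m t).integral_comp
    ((shear m).toHomeomorph t).measurableEmbedding fun x => f x * η (shear m (-t) x)
  rw [← cov]
  refine integral_congr_ae ?_
  filter_upwards [coeFn_freeGroup m t f] with x hx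
  rw [hx, ← Flow.map_add, neg_add_cancel, Flow.map_zero_apply]
  rfl

theorem hasDerivAt_comp_shear {η : ℝ × ℝ → ℂ} (hη : ContDiff ℝ ∞ η) (m t : ℝ) (x : ℝ × ℝ) :
    HasDerivAt (fun t => η (shear m (-t) x))
      (((x.2 / m : ℝ) : ℂ) * fderiv ℝ η (shear m (-t) x) (1, 0)) t := by
  have velocity : HasDerivAt (fun t => shear m (-t) x) ((x.2 / m) • (1, 0)) t := by
    have position : HasDerivAt (fun t : ℝ => x.1 + x.2 / m * t) (x.2 / m) t := by
      simpa using ((hasDerivAt_id t).const_mul (x.2 / m)).const_add x.1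
    have := position.prodMk (hasDerivAt_const t x.2)
    convert this using 1
    · funext s
      simp only [shear_apply, Prod.mk.injEq, and_true]
      ring
    · simp
  refine ((hη.differentiable (by simp)
    (shear m (-t) x)).hasFDerivAt.comp_hasDerivAt t velocity).congr_deriv ?_
  rw [map_smul, ← Complex.coe_smul, smul_eq_mul]

theorem hasDerivAt_integral_mul {X : Type*} [TopologicalSpace X] [T2Space X] [MeasurableSpace X]
    [OpensMeasurableSpace X] {μ : Measure X} {f : X → ℂ} (hf : LocallyIntegrable f μ)
    {Ψ Ψ' : ℝ → X → ℂ} (hΨ : ∀ t, Continuous (Ψ t)) (hΨ' : Continuous (Function.uncurry Ψ'))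
    (deriv : ∀ t x, HasDerivAt (fun t => Ψ t x) (Ψ' t x) t) {K : Set X} (hK : IsCompact K)
    (support : ∀ t ∈ Set.Icc (-1 : ℝ) 1, ∀ x ∉ K, Ψ t x = 0) :
    HasDerivAt (fun t => ∫ x, f x * Ψ t x ∂μ) (∫ x, f x * Ψ' 0 x ∂μ) 0 := by
  have nhds : Set.Icc (-1 : ℝ) 1 ∈ 𝓝 (0 : ℝ) := Icc_mem_nhds (by norm_num) (by norm_num)
  have support' : ∀ x ∉ K, Ψ' 0 x = 0 := fun x hx =>
    (deriv 0 x).unique ((hasDerivAt_const 0 0).congr_of_eventuallyEq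
      (eventually_of_mem nhds fun t ht => support t ht x hx))
  obtain ⟨C, hC⟩ := (isCompact_Icc.prod hK).exists_bound_of_continuousOn
    (s := Set.Icc (-1 : ℝ) 1 ×ˢ K) hΨ'.continuousOn
  have hfK : IntegrableOn f K μ := hf.integrableOn_isCompact hK
  have local_deriv := (hasDerivAt_integral_of_dominated_loc_of_deriv_le (μ := μ.restrict K) nhds
    (F := fun t x => f x * Ψ t x) (F' := fun t x => f x * Ψ' t x) (bound := fun x => ‖f x‖ * C)
    (Eventually.of_forall fun t => hfK.aestronglyMeasurable.mul (hΨ t).aestronglyMeasurable)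
    (hfK.mul_continuousOn (hΨ 0).continuousOn hK)
    (hfK.aestronglyMeasurable.mul (hΨ'.comp (.prodMk_right 0)).aestronglyMeasurable)
    ?_ (hfK.norm.mul_const C) (ae_of_all _ fun x t _ => (deriv t x).const_mul (f x))).2
  · rw [← setIntegral_eq_integral_of_forall_compl_eq_zero (s := K)
      fun x hx => by rw [support' x hx, mul_zero]]
    refine local_deriv.congr_of_eventuallyEq (eventually_of_mem nhds fun t ht => ?_)
    exact (setIntegral_eq_integral_of_forall_compl_eq_zero
      fun x hx => by rw [support t ht x hx, mul_zero]).symm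
  · filter_upwards [ae_restrict_mem hK.measurableSet] with x hx t ht
    rw [norm_mul]
    exact mul_le_mul_of_nonneg_left (hC (t, x) ⟨ht, hx⟩) (norm_nonneg _)

theorem hasDerivAt_integral_freeGroup_mul (m : ℝ) (f : PhaseL2) {η : ℝ × ℝ → ℂ}
    (hη : ContDiff ℝ ∞ η) (hs : HasCompactSupport η) :
    HasDerivAt (fun t => ∫ x, freeGroup m t f x * η x)
      (∫ x, f x * (((x.2 / m : ℝ) : ℂ) * fderiv ℝ η x (1, 0))) 0 := by
  have hη' : Continuous fun x => fderiv ℝ η x (1, 0) :=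
    (hη.continuous_fderiv (by simp)).clm_apply continuous_const
  have backward : Continuous fun y : ℝ × (ℝ × ℝ) => shear m (-y.1) y.2 :=
    (shear m).continuous (by fun_prop) (by fun_prop)
  have := hasDerivAt_integral_mul ((Lp.memLp f).locallyIntegrable (by norm_num))
    (Ψ := fun t x => η (shear m (-t) x))
    (Ψ' := fun t x => ((x.2 / m : ℝ) : ℂ) * fderiv ℝ η (shear m (-t) x) (1, 0))
    (fun t => hη.continuous.comp (backward.comp (.prodMk_right t)))
    ((by fun_prop : Continuous fun y : ℝ × (ℝ × ℝ) => ((y.2.2 / m : ℝ) : ℂ)).mul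
      (hη'.comp backward))
    (fun t => hasDerivAt_comp_shear hη m t)
    (((isCompact_Icc (a := (-1 : ℝ)) (b := 1)).prod hs).image
      ((shear m).continuous continuous_fst continuous_snd)) fun t ht x hx => ?_
  · simpa only [integral_freeGroup_mul, neg_zero, Flow.map_zero_apply] using this
  · by_contra h
    refine hx ⟨(t, shear m (-t) x), ⟨ht, subset_tsupport _ h⟩, ?_⟩
    simp only [← Flow.map_add, add_neg_cancel, Flow.map_zero_apply]

theorem eq_zero_of_forall_integral_test_eq_zero {f : PhaseL2}
    (h : ∀ η : ℝ × ℝ → ℂ, ContDiff ℝ ∞ η → HasCompactSupport η → ∫ x, f x * η x = 0) :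
    f = 0 := by
  rw [Lp.eq_zero_iff_ae_eq_zero]
  refine ae_eq_zero_of_integral_contDiff_smul_eq_zero
    ((Lp.memLp f).locallyIntegrable (by norm_num)) fun g hg hs => ?_
  rw [← h (fun x => (g x : ℂ)) (Complex.ofRealCLM.contDiff.comp hg)
    (hs.comp_left (g := fun r : ℝ => (r : ℂ)) (by simp))]
  exact integral_congr_ae (ae_of_all _ fun x => by simp [mul_comm])

/-- The functional `f ↦ ∫ f η` on `L²(ℝ²)` given by a square-integrable function `η`. -/
def pairing {η : ℝ × ℝ → ℂ} (hη : MemLp η 2) : PhaseL2 →L[ℂ] ℂ :=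
  ((ContinuousLinearMap.mul ℂ ℂ).lpPairing volume 2 2).flip (hη.toLp η)

theorem pairing_apply {η : ℝ × ℝ → ℂ} (hη : MemLp η 2) (f : PhaseL2) :
    pairing hη f = ∫ x, f x * η x := by
  rw [pairing, ContinuousLinearMap.flip_apply, ContinuousLinearMap.lpPairing_eq_integral]
  refine integral_congr_ae ?_
  filter_upwards [hη.coeFn_toLp] with x hx
  rw [hx, ContinuousLinearMap.mul_apply']

theorem isUnitaryGroup_freeGroup (m : ℝ) : IsUnitaryGroup (L0 m) (freeGroup m) := by
  have hU := isIsometricFlow_freeGroup m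
  refine ⟨hU.map_zero, hU.map_add, hU.continuous, fun f h => ?_⟩
  let ι := {η : ℝ × ℝ → ℂ // ContDiff ℝ ∞ η ∧ HasCompactSupport η}
  have memLp : ∀ η : ι, MemLp η.1 2 := fun η =>
    η.2.1.continuous.memLp_of_hasCompactSupport η.2.2
  rw [L0_graph, hU.tendsto_slope_iff_hasDerivAt, hU.hasDerivAt_iff_of_weak
    (fun η : ι => pairing (memLp η))
    (fun η f => ∫ x, f x * (((x.2 / m : ℝ) : ℂ) * fderiv ℝ η.1 x (1, 0)))]
  · have weak_iff : ∀ η : ι, pairing (memLp η) (-Complex.I • h) =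
        ∫ x, f x * (((x.2 / m : ℝ) : ℂ) * fderiv ℝ η.1 x (1, 0)) ↔ ∫ x, h x * η.1 x =
        ∫ x, f x * (Complex.I * ((x.2 / m : ℝ) : ℂ) * fderiv ℝ η.1 x (1, 0)) := by
      intro η
      simp only [mul_assoc, mul_left_comm _ Complex.I]
      rw [integral_const_mul, map_smul, smul_eq_mul, pairing_apply]
      refine ⟨fun e => ?_, fun e => ?_⟩
      · linear_combination Complex.I * e + (∫ x, h x * η.1 x) * Complex.I_mul_I
      · rw [e, ← mul_assoc, neg_mul, Complex.I_mul_I, neg_neg, one_mul]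
    simp only [weak_iff]
    exact ⟨fun hw η => hw η.1 η.2.1 η.2.2, fun hw η hη hs => hw ⟨η, hη, hs⟩⟩
  · intro f hf
    exact eq_zero_of_forall_integral_test_eq_zero fun η hη hs => by
      rw [← hf ⟨η, hη, hs⟩, pairing_apply]
  · intro η f
    simpa only [pairing_apply] using hasDerivAt_integral_freeGroup_mul m f η.2.1 η.2.2
  · intro η t
    refine ⟨⟨fun x => η.1 (shear m (-t) x), η.2.1.comp (contDiff_shear m (-t)),
      η.2.2.comp_homeomorph ((shear m).toHomeomorph (-t))⟩, fun f => ?_⟩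
    rw [pairing_apply, pairing_apply, integral_freeGroup_mul]

/-! ### Pointwise evaluation of `L^p`-valued integrals -/

section LpIntegral

variable {α T E : Type*} [MeasurableSpace α] {μ : Measure α} [NormedAddCommGroup E]
  {p : ENNReal} [Fact (1 ≤ p)] {S : Set α}

theorem integrableOn_Lp (f : Lp E p μ) (hS : μ S ≠ ⊤) : IntegrableOn f S μ := by
  have : IsFiniteMeasure (μ.restrict S) := ⟨by simpa using hS.lt_top⟩
  exact ((Lp.memLp f).restrict S).integrable Fact.out

theorem setIntegral_norm_le_Lp (f : Lp E p μ) (hS : μ S ≠ ⊤) :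
    ∫ x in S, ‖f x‖ ∂μ ≤ (μ S ^ (1 - 1 / p.toReal)).toReal * ‖f‖ := by
  have hölder := eLpNorm_le_eLpNorm_mul_rpow_measure_univ (Fact.out : 1 ≤ p)
    ((Lp.aestronglyMeasurable f).restrict (s := S))
  rw [Measure.restrict_apply_univ, ENNReal.toReal_one, div_one] at hölder
  have exponent : 0 ≤ 1 - 1 / p.toReal := by
    rcases eq_or_ne p ⊤ with rfl | hp
    · simp
    · have : 1 ≤ p.toReal := by
        simpa using ENNReal.toReal_mono hp (Fact.out : 1 ≤ p)
      rw [sub_nonneg]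
      exact div_le_one_of_le₀ this (by positivity)
  rw [integral_norm_eq_lintegral_enorm (integrableOn_Lp f hS).aestronglyMeasurable,
    ← eLpNorm_one_eq_lintegral_enorm, Lp.norm_def, mul_comm, ← ENNReal.toReal_mul]
  refine ENNReal.toReal_mono (ENNReal.mul_ne_top (Lp.eLpNorm_ne_top f)
    (ENNReal.rpow_ne_top_of_nonneg exponent hS)) (hölder.trans ?_)
  gcongr
  exact Measure.restrict_le_self

variable [MeasurableSpace T] {ν : Measure T} {Φ : T → Lp E p μ} {k : T → α → E}

theorem integrable_uncurry_of_integrable_Lp [SFinite ν] [SFinite μ] (hΦ : Integrable Φ ν)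
    (hk : AEStronglyMeasurable (Function.uncurry k) (ν.prod μ))
    (hΦk : ∀ᵐ s ∂ν, Φ s =ᵐ[μ] k s) (hS : μ S ≠ ⊤) :
    Integrable (Function.uncurry k) (ν.prod (μ.restrict S)) := by
  have hk' : AEStronglyMeasurable (Function.uncurry k) (ν.prod (μ.restrict S)) :=
    hk.mono_ac (Measure.AbsolutelyContinuous.rfl.prod Measure.restrict_le_self.absolutelyContinuous)
  refine (integrable_prod_iff hk').mpr ⟨?_, ?_⟩
  · filter_upwards [hΦk] with s hs
    exact (integrableOn_Lp (Φ s) hS).congr (ae_restrict_of_ae hs)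
  · refine (hΦ.norm.const_mul (μ S ^ (1 - 1 / p.toReal)).toReal).mono'
      hk'.norm.integral_prod_right' ?_
    filter_upwards [hΦk] with s hs
    rw [Real.norm_of_nonneg (by positivity)]
    refine le_of_eq_of_le (integral_congr_ae ?_) (setIntegral_norm_le_Lp (Φ s) hS)
    filter_upwards [ae_restrict_of_ae hs] with x hx
    rw [hx, Function.uncurry_apply_pair]

variable [NormedSpace ℝ E]

/-- Integration over a set of finite measure, as a functional on `L^p`. -/
def setIntegralLp (hS : μ S ≠ ⊤) : Lp E p μ →L[ℝ] E :=
  LinearMap.mkContinuous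
    { toFun f := ∫ x in S, f x ∂μ
      map_add' f g := by
        rw [← integral_add (integrableOn_Lp f hS) (integrableOn_Lp g hS)]
        exact integral_congr_ae (ae_restrict_of_ae (Lp.coeFn_add f g))
      map_smul' c f := by
        rw [RingHom.id_apply, ← integral_smul]
        exact integral_congr_ae (ae_restrict_of_ae (Lp.coeFn_smul c f)) }
    (μ S ^ (1 - 1 / p.toReal)).toReal
    fun f => (norm_integral_le_integral_norm _).trans (setIntegral_norm_le_Lp f hS)

theorem setIntegralLp_apply (hS : μ S ≠ ⊤) (f : Lp E p μ) :
    setIntegralLp hS f = ∫ x in S, f x ∂μ := rfl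

theorem coeFn_integral_Lp [CompleteSpace E] [SFinite ν] [SigmaFinite μ] (hΦ : Integrable Φ ν)
    (hk : AEStronglyMeasurable (Function.uncurry k) (ν.prod μ))
    (hΦk : ∀ᵐ s ∂ν, Φ s =ᵐ[μ] k s) :
    ⇑(∫ s, Φ s ∂ν) =ᵐ[μ] fun x => ∫ s, k s x ∂ν := by
  have hint : ∀ S, μ S < ⊤ → Integrable (Function.uncurry k) (ν.prod (μ.restrict S)) :=
    fun S hS => integrable_uncurry_of_integrable_Lp hΦ hk hΦk hS.ne
  refine ae_eq_of_forall_setIntegral_eq_of_sigmaFinite (fun S _ hS => integrableOn_Lp _ hS.ne)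
    (fun S _ hS => (hint S hS).integral_prod_right) fun S _ hS => ?_
  calc ∫ x in S, (∫ s, Φ s ∂ν : Lp E p μ) x ∂μ
      = ∫ s, setIntegralLp hS.ne (Φ s) ∂ν := by
        rw [(setIntegralLp hS.ne).integral_comp_comm hΦ, setIntegralLp_apply]
    _ = ∫ s, ∫ x in S, k s x ∂μ ∂ν := by
        refine integral_congr_ae ?_
        filter_upwards [hΦk] with s hs
        exact integral_congr_ae (ae_restrict_of_ae hs)
    _ = ∫ x in S, ∫ s, k s x ∂ν ∂μ := integral_integral_swap (hint S hS)

end LpIntegral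

/-! ### Phases acting on odd parts -/

section OddPhase

variable {G : Type*} [InvolutiveNeg G] {f g u v : G → ℂ}

/-- The even part of a function. -/
def evenPart (f : G → ℂ) : G → ℂ := (2⁻¹ : ℂ) • (f + f ∘ Neg.neg)

/-- The odd part of a function. -/
def oddPart (f : G → ℂ) : G → ℂ := (2⁻¹ : ℂ) • (f - f ∘ Neg.neg)

theorem evenPart_apply (f : G → ℂ) (x : G) : evenPart f x = 2⁻¹ * (f x + f (-x)) := rfl

theorem oddPart_apply (f : G → ℂ) (x : G) : oddPart f x = 2⁻¹ * (f x - f (-x)) := rfl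

theorem evenPart_comp_odd {T : G → G} (hT : T.Odd) (f : G → ℂ) :
    evenPart (f ∘ T) = evenPart f ∘ T := by
  ext x
  simp only [evenPart_apply, Function.comp_apply, hT x]

theorem oddPart_comp_odd {T : G → G} (hT : T.Odd) (f : G → ℂ) :
    oddPart (f ∘ T) = oddPart f ∘ T := by
  ext x
  simp only [oddPart_apply, Function.comp_apply, hT x]

/-- Multiplication of the odd part of `f` by `u`. -/
def mulOdd (u f : G → ℂ) : G → ℂ := evenPart f + u * oddPart f

theorem evenPart_add_oddPart (f : G → ℂ) : evenPart f + oddPart f = f := by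
  ext x
  simp only [evenPart_apply, oddPart_apply, Pi.add_apply]
  ring

theorem even_evenPart (f : G → ℂ) : (evenPart f).Even := fun x => by
  simp only [evenPart_apply, neg_neg, add_comm]

theorem odd_oddPart (f : G → ℂ) : (oddPart f).Odd := fun x => by
  simp only [oddPart_apply, neg_neg]
  ring

theorem evenPart_mulOdd (hu : u.Even) (f : G → ℂ) : evenPart (mulOdd u f) = evenPart f := by
  ext x
  simp only [evenPart_apply, mulOdd, oddPart_apply, Pi.add_apply, Pi.mul_apply, hu x, neg_neg]
  ring

theorem oddPart_mulOdd (hu : u.Even) (f : G → ℂ) : oddPart (mulOdd u f) = u * oddPart f := by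
  ext x
  simp only [evenPart_apply, mulOdd, oddPart_apply, Pi.add_apply, Pi.mul_apply, hu x, neg_neg]
  ring

theorem mulOdd_mulOdd (hu : u.Even) (f : G → ℂ) :
    mulOdd v (mulOdd u f) = mulOdd (v * u) f := by
  rw [mulOdd, evenPart_mulOdd hu, oddPart_mulOdd hu, mulOdd, mul_assoc]

theorem mulOdd_one (f : G → ℂ) : mulOdd 1 f = f := by
  rw [mulOdd, one_mul, evenPart_add_oddPart]

variable [MeasurableSpace G]

/-- A measurable even function of modulus one: multiplying the odd parts of square-integrable
functions by it is a unitary operator. -/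
structure IsEvenPhase (u : G → ℂ) : Prop where
  measurable : Measurable u
  even : u.Even
  norm_eq_one : ∀ x, ‖u x‖ = 1

namespace IsEvenPhase

theorem inv (hu : IsEvenPhase u) : IsEvenPhase u⁻¹ where
  measurable := hu.measurable.inv
  even x := by rw [Pi.inv_apply, Pi.inv_apply, hu.even]
  norm_eq_one x := by rw [Pi.inv_apply, norm_inv, hu.norm_eq_one, inv_one]

theorem mul_inv_eq_one (hu : IsEvenPhase u) : u * u⁻¹ = 1 := by
  ext x
  exact mul_inv_cancel₀ (norm_ne_zero_iff.1 (by rw [hu.norm_eq_one]; exact one_ne_zero))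

theorem mulOdd_inv_mulOdd (hu : IsEvenPhase u) (f : G → ℂ) : mulOdd u⁻¹ (mulOdd u f) = f := by
  rw [mulOdd_mulOdd hu.even, mul_comm, hu.mul_inv_eq_one, mulOdd_one]

theorem mulOdd_mulOdd_inv (hu : IsEvenPhase u) (f : G → ℂ) : mulOdd u (mulOdd u⁻¹ f) = f := by
  rw [mulOdd_mulOdd hu.inv.even, hu.mul_inv_eq_one, mulOdd_one]

theorem norm_sq_mulOdd_add_norm_sq_mulOdd_neg (hu : IsEvenPhase u) (f : G → ℂ) (x : G) :
    ‖mulOdd u f x‖ ^ 2 + ‖mulOdd u f (-x)‖ ^ 2 = ‖f x‖ ^ 2 + ‖f (-x)‖ ^ 2 := by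
  have parallelogram : ∀ w : G → ℂ, w.Even → ‖w x‖ = 1 →
      ‖mulOdd w f x‖ ^ 2 + ‖mulOdd w f (-x)‖ ^ 2 =
        2 * (‖evenPart f x‖ ^ 2 + ‖oddPart f x‖ ^ 2) := by
    intro w hw hwx
    simp only [mulOdd, Pi.add_apply, Pi.mul_apply, even_evenPart f x, odd_oddPart f x, hw x,
      mul_neg, ← sub_eq_add_neg]
    simpa only [← sq, norm_mul, hwx, one_mul] using
      parallelogram_law_with_norm ℝ (evenPart f x) (w x * oddPart f x)
  rw [parallelogram u hu.even (hu.norm_eq_one x), ← parallelogram 1 (fun _ => rfl) norm_one,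
    mulOdd_one]

end IsEvenPhase

variable [MeasurableNeg G]

theorem IsEvenPhase.measurable_mulOdd (hu : IsEvenPhase u) (hf : Measurable f) :
    Measurable (mulOdd u f) := by
  have hf' : Measurable (f ∘ Neg.neg) := hf.comp measurable_neg
  exact ((hf.add hf').const_smul _).add (hu.measurable.mul ((hf.sub hf').const_smul _))

variable {μ : Measure G} [μ.IsNegInvariant]

theorem mulOdd_congr_ae (u : G → ℂ) (h : f =ᵐ[μ] g) : mulOdd u f =ᵐ[μ] mulOdd u g := by
  filter_upwards [h, (Measure.measurePreserving_neg μ).quasiMeasurePreserving.ae h] with x hx hx'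
  simp only [mulOdd, evenPart_apply, oddPart_apply, Pi.add_apply, Pi.mul_apply, hx, hx']

theorem memLp_evenPart {p : ENNReal} (hf : MemLp f p μ) : MemLp (evenPart f) p μ :=
  (hf.add (hf.comp_measurePreserving (Measure.measurePreserving_neg μ))).const_smul (2⁻¹ : ℂ)

theorem memLp_oddPart {p : ENNReal} (hf : MemLp f p μ) : MemLp (oddPart f) p μ :=
  (hf.sub (hf.comp_measurePreserving (Measure.measurePreserving_neg μ))).const_smul (2⁻¹ : ℂ)

namespace IsEvenPhase

theorem memLp_mulOdd {p : ENNReal} (hu : IsEvenPhase u) (hf : MemLp f p μ) :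
    MemLp (mulOdd u f) p μ := by
  have hodd := memLp_oddPart hf
  refine (memLp_evenPart hf).add (hodd.of_le (hu.measurable.aestronglyMeasurable.mul hodd.1)
    (ae_of_all _ fun x => ?_))
  rw [Pi.mul_apply, norm_mul, hu.norm_eq_one, one_mul]

theorem integral_norm_sq_mulOdd (hu : IsEvenPhase u) (hf : MemLp f 2 μ) :
    ∫ x, ‖mulOdd u f x‖ ^ 2 ∂μ = ∫ x, ‖f x‖ ^ 2 ∂μ := by
  have symmetrize : ∀ h : G → ℂ, MemLp h 2 μ →
      ∫ x, (‖h x‖ ^ 2 + ‖h (-x)‖ ^ 2) ∂μ = 2 * ∫ x, ‖h x‖ ^ 2 ∂μ := by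
    intro h hh
    have hint : Integrable (fun x => ‖h x‖ ^ 2) μ := hh.integrable_norm_pow (by norm_num)
    have hint' : Integrable (fun x => ‖h (-x)‖ ^ 2) μ :=
      (Measure.measurePreserving_neg μ).integrable_comp_of_integrable hint
    rw [integral_add hint hint', two_mul, (Measure.measurePreserving_neg μ).integral_comp
      (MeasurableEquiv.neg G).measurableEmbedding fun x => ‖h x‖ ^ 2]
  have key := symmetrize _ (hu.memLp_mulOdd hf)
  simp only [hu.norm_sq_mulOdd_add_norm_sq_mulOdd_neg, symmetrize f hf] at key
  linarith

theorem eLpNorm_mulOdd (hu : IsEvenPhase u) (hf : MemLp f 2 μ) :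
    eLpNorm (mulOdd u f) 2 μ = eLpNorm f 2 μ := by
  rw [(hu.memLp_mulOdd hf).eLpNorm_eq_integral_rpow_norm two_ne_zero ENNReal.ofNat_ne_top,
    hf.eLpNorm_eq_integral_rpow_norm two_ne_zero ENNReal.ofNat_ne_top]
  simp only [ENNReal.toReal_ofNat, Real.rpow_two, hu.integral_norm_sq_mulOdd hf]

/-- `mulOdd u` as a linear map on `L²`. -/
def linearMap (hu : IsEvenPhase u) : Lp ℂ 2 μ →ₗ[ℂ] Lp ℂ 2 μ where
  toFun f := (hu.memLp_mulOdd (Lp.memLp f)).toLp _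
  map_add' f g := by
    rw [← MemLp.toLp_add, MemLp.toLp_eq_toLp_iff]
    refine (mulOdd_congr_ae u (Lp.coeFn_add f g)).trans (ae_of_all _ fun x => ?_)
    simp only [mulOdd, evenPart_apply, oddPart_apply, Pi.add_apply, Pi.mul_apply]
    ring
  map_smul' c f := by
    rw [RingHom.id_apply, ← MemLp.toLp_const_smul, MemLp.toLp_eq_toLp_iff]
    refine (mulOdd_congr_ae u (Lp.coeFn_smul c f)).trans (ae_of_all _ fun x => ?_)
    simp only [mulOdd, evenPart_apply, oddPart_apply, Pi.add_apply, Pi.mul_apply, Pi.smul_apply,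
      smul_eq_mul]
    ring

theorem coeFn_linearMap (hu : IsEvenPhase u) (f : Lp ℂ 2 μ) :
    hu.linearMap f =ᵐ[μ] mulOdd u f :=
  (hu.memLp_mulOdd (Lp.memLp f)).coeFn_toLp

theorem linearMap_inv_linearMap (hu : IsEvenPhase u) (f : Lp ℂ 2 μ) :
    hu.inv.linearMap (hu.linearMap f) = f := by
  refine Lp.ext (((hu.inv.coeFn_linearMap _).trans
    (mulOdd_congr_ae _ (hu.coeFn_linearMap f))).trans ?_)
  rw [hu.mulOdd_inv_mulOdd]

theorem linearMap_linearMap_inv (hu : IsEvenPhase u) (f : Lp ℂ 2 μ) :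
    hu.linearMap (hu.inv.linearMap f) = f := by
  refine Lp.ext (((hu.coeFn_linearMap _).trans
    (mulOdd_congr_ae _ (hu.inv.coeFn_linearMap f))).trans ?_)
  rw [hu.mulOdd_mulOdd_inv]

theorem norm_linearMap (hu : IsEvenPhase u) (f : Lp ℂ 2 μ) : ‖hu.linearMap f‖ = ‖f‖ := by
  rw [Lp.norm_def, Lp.norm_def, eLpNorm_congr_ae (hu.coeFn_linearMap f),
    hu.eLpNorm_mulOdd (Lp.memLp f)]

/-- `mulOdd u` as a unitary operator on `L²`. -/
def isometryEquiv (hu : IsEvenPhase u) : Lp ℂ 2 μ ≃ₗᵢ[ℂ] Lp ℂ 2 μ where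
  toLinearEquiv := LinearEquiv.ofLinearMap hu.linearMap hu.inv.linearMap
    (LinearMap.ext hu.linearMap_linearMap_inv) (LinearMap.ext hu.linearMap_inv_linearMap)
  norm_map' := hu.norm_linearMap

theorem coeFn_isometryEquiv (hu : IsEvenPhase u) (f : Lp ℂ 2 μ) :
    hu.isometryEquiv f =ᵐ[μ] mulOdd u f := hu.coeFn_linearMap f

theorem coeFn_isometryEquiv_symm (hu : IsEvenPhase u) (f : Lp ℂ 2 μ) :
    hu.isometryEquiv.symm f =ᵐ[μ] mulOdd u⁻¹ f := hu.inv.coeFn_linearMap f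

end IsEvenPhase

end OddPhase

/-! ### The perturbed group -/

/-- The dimensionless ratio `2 |p| / (m B(p))`. -/
def kappa (m : ℝ) (b : OnePoint ℝ) (p : ℝ) : ℝ := 2 * |p| / m * recip (Bfun b p)

theorem measurable_kappa (m : ℝ) (b : OnePoint ℝ) : Measurable (kappa m b) := by
  have recip_Bfun : Measurable fun p => recip (Bfun b p) := by
    induction b using OnePoint.rec with
    | infty => exact measurable_const
    | coe r =>
      change Measurable fun p : ℝ => (r * p ^ 2)⁻¹
      fun_prop
  unfold kappa
  fun_prop

theorem even_kappa (m : ℝ) (b : OnePoint ℝ) : (kappa m b).Even := fun p => by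
  simp only [kappa, Bfun, abs_neg, neg_sq]

theorem one_add_I_mul_ne_zero (k : ℝ) : (1 : ℂ) + Complex.I * k ≠ 0 :=
  fun h => by simpa using congrArg Complex.re h

theorem one_sub_I_mul_ne_zero (k : ℝ) : (1 : ℂ) - Complex.I * k ≠ 0 :=
  fun h => by simpa using congrArg Complex.re h

/-- The phase shift between the two sides of the line `q = 0`: incoming and outgoing points are
distinguished by the sign of `q p`. -/
def phase (m : ℝ) (b : OnePoint ℝ) (x : ℝ × ℝ) : ℂ :=
  if 0 < x.1 * x.2 then -(1 + Complex.I * kappa m b x.2) / (1 - Complex.I * kappa m b x.2) else 1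

theorem phase_of_pos (m : ℝ) (b : OnePoint ℝ) {x : ℝ × ℝ} (hx : 0 < x.1 * x.2) :
    phase m b x = -(1 + Complex.I * kappa m b x.2) / (1 - Complex.I * kappa m b x.2) := if_pos hx

theorem phase_of_neg (m : ℝ) (b : OnePoint ℝ) {x : ℝ × ℝ} (hx : x.1 * x.2 < 0) :
    phase m b x = 1 := if_neg hx.not_gt

theorem isEvenPhase_phase (m : ℝ) (b : OnePoint ℝ) : IsEvenPhase (phase m b) where
  measurable := by
    have := measurable_kappa m b
    refine Measurable.ite (measurableSet_lt measurable_const (by fun_prop)) ?_ measurable_const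
    fun_prop
  even x := by
    simp only [phase, Prod.fst_neg, Prod.snd_neg, neg_mul_neg, even_kappa m b x.2]
  norm_eq_one x := by
    have conj_eq : star (1 - Complex.I * kappa m b x.2) = 1 + Complex.I * kappa m b x.2 := by simp
    rw [phase]
    split_ifs
    · rw [← conj_eq, norm_div, norm_neg, norm_star, div_self]
      exact norm_ne_zero_iff.2 (one_sub_I_mul_ne_zero _)
    · exact norm_one

/-- The coefficient of the scattered part of the wave at time `t`. -/
def scatterCoeff (m : ℝ) (b : OnePoint ℝ) (t : ℝ) (x : ℝ × ℝ) : ℂ :=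
  ((heaviside (t * x.1 * x.2) * heaviside (|x.2 * t| / m - |x.1|) : ℝ) : ℂ) /
    (1 + (Real.sign t : ℂ) * (2 * Complex.I * |x.2| / m * (recip (Bfun b x.2) : ℂ)))

theorem heaviside_mul_heaviside {m : ℝ} (hm : 0 < m) (t q p : ℝ) :
    heaviside (t * q * p) * heaviside (|p * t| / m - |q|) =
      if q * (q - p * t / m) < 0 then 1 else 0 := by
  have h₁ : 0 < t * q * p ↔ 0 < q * (p * t / m) := by
    rw [show t * q * p = m * (q * (p * t / m)) by field_simp, mul_pos_iff_of_pos_left hm]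
  have h₂ : |p * t| / m = |p * t / m| := by rw [abs_div, abs_of_pos hm]
  have crossing : 0 < q * (p * t / m) ∧ 0 < |p * t| / m - |q| ↔ q * (q - p * t / m) < 0 := by
    rw [h₂]
    generalize p * t / m = a
    rw [sub_pos, ← sq_lt_sq, mul_sub, sub_neg]
    refine ⟨fun h => by nlinarith [h.1, h.2], fun h => ⟨?_, ?_⟩⟩
    · nlinarith [mul_self_nonneg q]
    · nlinarith [sq_nonneg (a - q)]
  simp only [heaviside, h₁, ite_zero_mul_ite_zero, crossing, mul_one]

theorem scatterCoeff_eq {m : ℝ} (hm : 0 < m) (b : OnePoint ℝ) (t : ℝ) (x : ℝ × ℝ) :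
    scatterCoeff m b t x = if x.1 * (shear m t x).1 < 0 then
      (1 + (Real.sign t : ℂ) * (Complex.I * kappa m b x.2))⁻¹ else 0 := by
  have denominator : 2 * Complex.I * |x.2| / m * (recip (Bfun b x.2) : ℂ) =
      Complex.I * kappa m b x.2 := by
    rw [kappa]
    push_cast
    ring
  rw [scatterCoeff, heaviside_mul_heaviside hm, denominator, shear_apply]
  split_ifs <;> simp

theorem phase_inv_mul_phase_shear {m : ℝ} (hm : 0 < m) (b : OnePoint ℝ) (t : ℝ) {x : ℝ × ℝ}
    (hq : x.1 ≠ 0) (hp : x.2 ≠ 0) (hq' : (shear m t x).1 ≠ 0) :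
    (phase m b x)⁻¹ * phase m b (shear m t x) = 1 - 2 * scatterCoeff m b t x := by
  have displacement : (shear m t x).1 * (shear m t x).2 = x.1 * x.2 - x.2 ^ 2 / m * t := by
    rw [shear_apply]
    ring
  have crossing : x.1 * (shear m t x).1 < 0 ↔
      x.1 * x.2 * ((shear m t x).1 * (shear m t x).2) < 0 := by
    have : x.1 * x.2 * ((shear m t x).1 * (shear m t x).2) = x.1 * (shear m t x).1 * x.2 ^ 2 := by
      rw [shear_apply]
      ring
    rw [this]
    exact ⟨fun h => mul_neg_of_neg_of_pos h (by positivity),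
      fun h => neg_of_mul_neg_left h (sq_nonneg _)⟩
  have speed : 0 < x.2 ^ 2 / m := by positivity
  have same_momentum : (shear m t x).2 = x.2 := rfl
  have one_add := one_add_I_mul_ne_zero (kappa m b x.2)
  have one_sub := one_sub_I_mul_ne_zero (kappa m b x.2)
  rw [scatterCoeff_eq hm]
  simp only [crossing]
  rcases (mul_ne_zero hq hp).lt_or_gt with hx | hx <;>
    rcases (mul_ne_zero hq' hp : (shear m t x).1 * (shear m t x).2 ≠ 0).lt_or_gt with hy | hy
  · rw [phase_of_neg m b hx, phase_of_neg m b hy, if_neg (mul_pos_of_neg_of_neg hx hy).not_gt]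
    simp
  · have ht : t < 0 := (pos_iff_neg_of_mul_neg (by linarith)).1 speed
    rw [phase_of_neg m b hx, phase_of_pos m b hy, if_pos (mul_neg_of_neg_of_pos hx hy),
      Real.sign_of_neg ht, same_momentum]
    push_cast
    rw [neg_one_mul, ← sub_eq_add_neg]
    field_simp
    ring
  · have ht : 0 < t := (pos_iff_pos_of_mul_pos (by linarith)).1 speed
    rw [phase_of_pos m b hx, phase_of_neg m b hy, if_pos (mul_neg_of_pos_of_neg hx hy),
      Real.sign_of_pos ht]
    push_cast
    field_simp
    ring
  · rw [phase_of_pos m b hx, phase_of_pos m b hy, if_neg (mul_pos hx hy).not_gt, same_momentum]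
    field_simp
    simp

theorem odd_shear (m t : ℝ) : Function.Odd (shear m t) := fun x => by
  simp only [shear_apply, Prod.fst_neg, Prod.snd_neg, Prod.neg_mk, Prod.mk.injEq, and_true]
  ring

/-- The free group conjugated by the phase shift of odd functions. -/
def perturbedGroup (m : ℝ) (b : OnePoint ℝ) (t : ℝ) : PhaseL2 ≃ₗᵢ[ℂ] PhaseL2 :=
  ((isEvenPhase_phase m b).isometryEquiv.trans (freeGroup m t)).trans
    (isEvenPhase_phase m b).isometryEquiv.symm

theorem isIsometricFlow_perturbedGroup (m : ℝ) (b : OnePoint ℝ) :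
    IsIsometricFlow (perturbedGroup m b) :=
  (isIsometricFlow_freeGroup m).conj _

theorem ae_fst_ne_zero : ∀ᵐ x : ℝ × ℝ, x.1 ≠ 0 :=
  Measure.quasiMeasurePreserving_fst.ae (Measure.ae_ne volume (0 : ℝ))

theorem ae_snd_ne_zero : ∀ᵐ x : ℝ × ℝ, x.2 ≠ 0 :=
  Measure.quasiMeasurePreserving_snd.ae (Measure.ae_ne volume (0 : ℝ))

theorem coeFn_perturbedGroup {m : ℝ} (hm : 0 < m) (b : OnePoint ℝ) (t : ℝ) (f : PhaseL2) :
    perturbedGroup m b t f =ᵐ[volume]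
      fun x => freeFlow m t f x - scatterCoeff m b t x * freeFlow m t (fOdd f) x := by
  have hu := isEvenPhase_phase m b
  have shear_ae := (measurePreserving_shear m t).quasiMeasurePreserving
  have transported : freeGroup m t (hu.isometryEquiv f) =ᵐ[volume]
      mulOdd (phase m b) f ∘ shear m t :=
    (coeFn_freeGroup m t _).trans (shear_ae.ae (hu.coeFn_isometryEquiv f))
  filter_upwards [(hu.coeFn_isometryEquiv_symm _).trans (mulOdd_congr_ae _ transported),
    ae_fst_ne_zero, ae_snd_ne_zero, shear_ae.ae ae_fst_ne_zero] with x hx hq hp hq'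
  refine hx.trans ?_
  have free : freeFlow m t f x = f (shear m t x) := rfl
  have freeOdd : freeFlow m t (fOdd f) x = f (shear m t x) - f (-shear m t x) := rfl
  rw [mulOdd, evenPart_comp_odd (odd_shear m t), oddPart_comp_odd (odd_shear m t),
    evenPart_mulOdd hu.even, oddPart_mulOdd hu.even, free, freeOdd]
  simp only [Pi.add_apply, Pi.mul_apply, Pi.inv_apply, Function.comp_apply]
  rw [← mul_assoc, phase_inv_mul_phase_shear hm b t hq hp hq', evenPart_apply, oddPart_apply]
  ring

/-! ### Resolvents along a trajectory -/

section Transport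

/-- The Laplace transform `∫₀^∞ e^{ws} G (q - c s) ds` along a trajectory of velocity `c`, which
inverts `c ∂ - w` for `Re w < 0`. -/
def transportResolvent (w : ℂ) (c : ℝ) (G : ℝ → ℂ) (q : ℝ) : ℂ :=
  ∫ s in Set.Ioi (0 : ℝ), Complex.exp (w * s) * G (q - c * s)

theorem memLp_exp_mul_Ioi {w : ℂ} (hw : w.re < 0) (a : ℝ) :
    MemLp (fun s : ℝ => Complex.exp (w * s)) 2 (volume.restrict (Set.Ioi a)) := by
  refine (memLp_two_iff_integrable_sq_norm (by fun_prop)).2 ?_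
  refine (integrableOn_exp_mul_complex_Ioi (a := 2 * w) (by simpa using by linarith) a).norm.congr
    (ae_of_all _ fun s => ?_)
  simp only [← norm_pow, ← Complex.exp_nat_mul]
  push_cast
  ring_nf

theorem memLp_comp_sub_mul {E : Type*} [NormedAddCommGroup E] {p : ENNReal} {G : ℝ → E}
    (hG : MemLp G p) (q : ℝ) {c : ℝ} (hc : c ≠ 0) : MemLp (fun s => G (q - c * s)) p := by
  have reflected := hG.comp_measurePreserving (Measure.measurePreserving_sub_left volume q)
  have dilated : MemLp (fun s => G (q - s)) p (volume.map (c * ·)) := by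
    rw [Real.map_volume_mul_left hc]
    exact reflected.smul_measure ENNReal.ofReal_ne_top
  exact dilated.comp_of_map (by fun_prop)

variable {w : ℂ} {c : ℝ} {G : ℝ → ℂ}

theorem integrableOn_exp_mul_comp_sub_mul (hw : w.re < 0) (hc : c ≠ 0) (hG : MemLp G 2)
    (q a : ℝ) : IntegrableOn (fun s : ℝ => Complex.exp (w * s) * G (q - c * s)) (Set.Ioi a) :=
  (memLp_exp_mul_Ioi hw a).integrable_mul ((memLp_comp_sub_mul hG q hc).restrict _)

/-- Time is measured from the passage through the origin on the right-hand side. -/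
theorem setIntegral_exp_mul_comp_sub_mul (w : ℂ) (hc : c ≠ 0) (G : ℝ → ℂ) (q a : ℝ) :
    ∫ s in Set.Ioi a, Complex.exp (w * s) * G (q - c * s) =
      Complex.exp (w * (q / c : ℝ)) *
        ∫ s in Set.Ioi (a - q / c), Complex.exp (w * s) * G (0 - c * s) := by
  have shift := (measurePreserving_add_right volume (q / c)).setIntegral_preimage_emb
    (measurableEmbedding_addRight (q / c))
    (fun s : ℝ => Complex.exp (w * s) * G (q - c * s)) (Set.Ioi a)
  rw [Set.preimage_add_const_Ioi] at shift
  rw [← shift, ← integral_const_mul]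
  refine integral_congr_ae (ae_of_all _ fun s => ?_)
  simp only
  rw [← mul_assoc, ← Complex.exp_add]
  congr 2
  · push_cast
    ring
  · field_simp
    ring

theorem transportResolvent_add {H : ℝ → ℂ} (hw : w.re < 0) (hc : c ≠ 0) (hG : MemLp G 2)
    (hH : MemLp H 2) (q : ℝ) : transportResolvent w c (fun q => G q + H q) q =
      transportResolvent w c G q + transportResolvent w c H q := by
  simp only [transportResolvent, mul_add]
  exact integral_add (integrableOn_exp_mul_comp_sub_mul hw hc hG q 0)
    (integrableOn_exp_mul_comp_sub_mul hw hc hH q 0)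

theorem transportResolvent_const_mul (w : ℂ) (c : ℝ) (a : ℂ) (G : ℝ → ℂ) (q : ℝ) :
    transportResolvent w c (fun q => a * G q) q = a * transportResolvent w c G q := by
  simp only [transportResolvent, mul_left_comm _ a, integral_const_mul]

theorem continuous_transportResolvent (hw : w.re < 0) (hc : c ≠ 0) (hG : MemLp G 2) :
    Continuous (transportResolvent w c G) := by
  have primitive : Continuous fun a : ℝ =>
      ∫ s in Set.Ioi a, Complex.exp (w * s) * G (0 - c * s) :=
    continuous_iff_continuousAt.2 fun a =>
      ((integrableOn_exp_mul_comp_sub_mul hw hc hG 0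
        (a - 1)).continuousOn_Ici_primitive_Ioi).continuousAt (Ici_mem_nhds (sub_one_lt a))
  exact (by fun_prop : Continuous fun q : ℝ => Complex.exp (w * (q / c : ℝ))).mul
    (primitive.comp (by fun_prop : Continuous fun q : ℝ => 0 - q / c)) |>.congr
      fun q => (setIntegral_exp_mul_comp_sub_mul w hc G q 0).symm

theorem mul_sub_neg_iff {q c s : ℝ} (hs : 0 < s) :
    q * (q - c * s) < 0 ↔ 0 < q * c ∧ q / c < s := by
  have expand : q * (q - c * s) = q * q - q * c * s := by ring
  rw [expand, sub_neg]
  have passed (hqc : 0 < q * c) : q / c < s ↔ q * q < q * c * s := by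
    rw [← mul_div_mul_left q c (left_ne_zero_of_mul hqc.ne'), div_lt_iff₀ hqc, mul_comm s]
  refine ⟨fun h => ?_, fun h => (passed h.1).1 h.2⟩
  have hqc : 0 < q * c := pos_of_mul_pos_left ((mul_self_nonneg q).trans_lt h) hs.le
  exact ⟨hqc, (passed hqc).2 h⟩

theorem setIntegral_crossing (hw : w.re < 0) (hc : c ≠ 0) (hG : MemLp G 2) (a : ℂ) (q : ℝ) :
    ∫ s in Set.Ioi (0 : ℝ), Complex.exp (w * s) *
        ((1 - if q * (q - c * s) < 0 then a else 0) * G (q - c * s)) =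
      transportResolvent w c G q - if 0 < q * c then
        a * Complex.exp (w * (q / c : ℝ)) * transportResolvent w c G 0 else 0 := by
  set H : ℝ → ℂ := fun s => Complex.exp (w * s) * G (q - c * s)
  have hH : ∀ r, IntegrableOn H (Set.Ioi r) := integrableOn_exp_mul_comp_sub_mul hw hc hG q
  by_cases hqc : 0 < q * c
  · have delay : 0 ≤ q / c := by
      rw [← mul_div_mul_right q c hc]
      exact div_nonneg hqc.le (mul_self_nonneg c)
    have split : ∀ s ∈ Set.Ioi (0 : ℝ), Complex.exp (w * s) *
        ((1 - if q * (q - c * s) < 0 then a else 0) * G (q - c * s)) =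
        H s - (Set.Ioi (q / c)).indicator (fun s => a * H s) s := by
      intro s hs
      simp only [mul_sub_neg_iff hs, hqc, true_and, Set.indicator_apply, Set.mem_Ioi, H]
      split_ifs <;> ring
    rw [if_pos hqc, setIntegral_congr_fun measurableSet_Ioi split, integral_sub (hH 0)
      (((hH 0).const_mul a).indicator measurableSet_Ioi),
      setIntegral_indicator measurableSet_Ioi, Set.Ioi_inter_Ioi, sup_of_le_right delay,
      integral_const_mul, setIntegral_exp_mul_comp_sub_mul w hc G q (q / c), sub_self, mul_assoc]
    rfl
  · have no_crossing : ∀ s ∈ Set.Ioi (0 : ℝ), Complex.exp (w * s) *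
        ((1 - if q * (q - c * s) < 0 then a else 0) * G (q - c * s)) = H s := by
      intro s hs
      simp only [mul_sub_neg_iff hs, hqc, false_and, if_false, sub_zero, one_mul, H]
    rw [if_neg hqc, setIntegral_congr_fun measurableSet_Ioi no_crossing, sub_zero]
    rfl

end Transport

/-! ### The free resolvent -/

/-- The free resolvent `(L₀ - z)⁻¹`, computed along the trajectories of the free motion. -/
def freeResolvent (m : ℝ) (z : ℂ) (g : ℝ × ℝ → ℂ) (x : ℝ × ℝ) : ℂ :=
  Complex.I * (Real.sign z.im : ℂ) * transportResolvent (Complex.I * (Real.sign z.im : ℂ) * z)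
    (Real.sign z.im * x.2 / m) (fun q => g (q, x.2)) x.1

theorem shear_sign_mul (m σ s : ℝ) (x : ℝ × ℝ) :
    shear m (σ * s) x = (x.1 - σ * x.2 / m * s, x.2) := by
  rw [shear_apply, mul_left_comm, mul_div_right_comm, mul_div_assoc, mul_comm σ]
  ring_nf

theorem freeResolvent_eq_setIntegral (m : ℝ) (z : ℂ) (g : ℝ × ℝ → ℂ) (x : ℝ × ℝ) :
    freeResolvent m z g x = Complex.I * (Real.sign z.im : ℂ) * ∫ s in Set.Ioi (0 : ℝ),
      Complex.exp (Complex.I * (Real.sign z.im : ℂ) * z * s) *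
        g (shear m (Real.sign z.im * s) x) := by
  simp only [freeResolvent, transportResolvent, shear_sign_mul]

theorem coeFn_laplaceResolvent_freeGroup (m : ℝ) {z : ℂ} (hz : z.im ≠ 0) {f : PhaseL2}
    {g : ℝ × ℝ → ℂ} (hg : Measurable g) (hfg : f =ᵐ[volume] g) :
    (laplaceResolvent (freeGroup m) z f : PhaseL2) =ᵐ[volume] freeResolvent m z g := by
  have orbit : ∀ s : ℝ, ⇑(Complex.exp (Complex.I * (Real.sign z.im : ℂ) * z * s) •
      freeGroup m (Real.sign z.im * s) f) =ᵐ[volume] fun x =>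
      Complex.exp (Complex.I * (Real.sign z.im : ℂ) * z * s) *
        g (shear m (Real.sign z.im * s) x) := by
    intro s
    filter_upwards [Lp.coeFn_smul (Complex.exp (Complex.I * (Real.sign z.im : ℂ) * z * s))
      (freeGroup m (Real.sign z.im * s) f), coeFn_freeGroup m (Real.sign z.im * s) f,
      (measurePreserving_shear m (Real.sign z.im * s)).quasiMeasurePreserving.ae hfg]
      with x smul free rep
    rw [smul, Pi.smul_apply, free, smul_eq_mul, ← rep]
    rfl
  have measurable : Measurable (Function.uncurry fun (s : ℝ) (x : ℝ × ℝ) =>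
      Complex.exp (Complex.I * (Real.sign z.im : ℂ) * z * s) *
        g (shear m (Real.sign z.im * s) x)) := by
    simp only [Function.uncurry_def, shear_apply]
    fun_prop
  have integrable := ((isIsometricFlow_freeGroup m).comp_mul_left
    (Real.sign z.im)).integrableOn_exp_smul (re_I_mul_sign_mul_neg hz) f 0
  filter_upwards [coeFn_integral_Lp integrable measurable.aestronglyMeasurable
    (ae_of_all _ orbit), Lp.coeFn_smul (Complex.I * (Real.sign z.im : ℂ)) (laplaceTransform
      (fun s => freeGroup m (Real.sign z.im * s)) (Complex.I * (Real.sign z.im : ℂ) * z) f)]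
    with x pointwise smul
  rw [laplaceResolvent, smul, freeResolvent_eq_setIntegral, ← pointwise]
  rfl

theorem ae_ae_of_ae_swap {α β : Type*} [MeasurableSpace α] [MeasurableSpace β] {μ : Measure α}
    {ν : Measure β} [SFinite μ] [SFinite ν] {P : α × β → Prop} (h : ∀ᵐ x ∂μ.prod ν, P x) :
    ∀ᵐ y ∂ν, ∀ᵐ x ∂μ, P (x, y) :=
  Measure.ae_ae_of_ae_prod
    ((Measure.measurePreserving_swap (μ := ν) (ν := μ)).quasiMeasurePreserving.ae h)

theorem ae_memLp_section {α β E : Type*} [MeasurableSpace α] [MeasurableSpace β]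
    [NormedAddCommGroup E] {μ : Measure α} {ν : Measure β} [SFinite μ] [SFinite ν]
    {g : α × β → E} (hg : MemLp g 2 (μ.prod ν)) : ∀ᵐ y ∂ν, MemLp (fun x => g (x, y)) 2 μ := by
  have swapped := hg.comp_measurePreserving (Measure.measurePreserving_swap (μ := ν) (ν := μ))
  filter_upwards [(hg.integrable_norm_pow (by norm_num)).prod_left_ae,
    swapped.aestronglyMeasurable.prodMk_left] with y integrable measurable
  exact (memLp_two_iff_integrable_sq_norm measurable).2 integrable

theorem ae_memLp_section_snd {g : ℝ × ℝ → ℂ} (hg : MemLp g 2) :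
    ∀ᵐ x : ℝ × ℝ, MemLp (fun q => g (q, x.2)) 2 :=
  Measure.quasiMeasurePreserving_snd.ae (ae_memLp_section hg)

theorem ae_memLp_section_neg_snd {g : ℝ × ℝ → ℂ} (hg : MemLp g 2) :
    ∀ᵐ x : ℝ × ℝ, MemLp (fun q => g (q, -x.2)) 2 :=
  Measure.quasiMeasurePreserving_snd.ae ((Measure.measurePreserving_neg
    volume).quasiMeasurePreserving.ae (ae_memLp_section hg))

theorem sign_mul_div_ne_zero {m a p : ℝ} (hm : m ≠ 0) (ha : a ≠ 0) (hp : p ≠ 0) :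
    Real.sign a * p / m ≠ 0 :=
  div_ne_zero (mul_ne_zero (mt Real.sign_eq_zero_iff.1 ha) hp) hm

theorem continuous_freeResolvent {m : ℝ} (hm : m ≠ 0) {z : ℂ} (hz : z.im ≠ 0) {g : ℝ × ℝ → ℂ}
    {p : ℝ} (hp : p ≠ 0) (hg : MemLp (fun q => g (q, p)) 2) :
    Continuous fun q => freeResolvent m z g (q, p) :=
  continuous_const.mul (continuous_transportResolvent (re_I_mul_sign_mul_neg hz)
    (sign_mul_div_ne_zero hm hz hp) hg)

theorem freeResolvent_add {m : ℝ} (hm : m ≠ 0) {z : ℂ} (hz : z.im ≠ 0) {g h : ℝ × ℝ → ℂ}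
    {x : ℝ × ℝ} (hp : x.2 ≠ 0) (hg : MemLp (fun q => g (q, x.2)) 2)
    (hh : MemLp (fun q => h (q, x.2)) 2) :
    freeResolvent m z (g + h) x = freeResolvent m z g x + freeResolvent m z h x := by
  simp only [freeResolvent, Pi.add_apply, ← mul_add]
  rw [transportResolvent_add (re_I_mul_sign_mul_neg hz) (sign_mul_div_ne_zero hm hz hp) hg hh]

theorem freeResolvent_smul (m : ℝ) (z a : ℂ) (g : ℝ × ℝ → ℂ) (x : ℝ × ℝ) :
    freeResolvent m z (a • g) x = a * freeResolvent m z g x := by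
  simp only [freeResolvent, Pi.smul_apply, smul_eq_mul, transportResolvent_const_mul,
    mul_left_comm _ a]

theorem freeResolvent_comp_neg (m : ℝ) (z : ℂ) (g : ℝ × ℝ → ℂ) (x : ℝ × ℝ) :
    freeResolvent m z (g ∘ Neg.neg) x = freeResolvent m z g (-x) := by
  simp only [freeResolvent_eq_setIntegral, Function.comp_apply, odd_shear m _ x]

theorem evenPart_freeResolvent {m : ℝ} (hm : m ≠ 0) {z : ℂ} (hz : z.im ≠ 0) {g : ℝ × ℝ → ℂ}
    {x : ℝ × ℝ} (hp : x.2 ≠ 0) (hg : MemLp (fun q => g (q, x.2)) 2)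
    (hg' : MemLp (fun q => g (q, -x.2)) 2) :
    evenPart (freeResolvent m z g) x = freeResolvent m z (evenPart g) x := by
  have reflected : MemLp (fun q => (g ∘ Neg.neg) (q, x.2)) 2 :=
    hg'.comp_measurePreserving (Measure.measurePreserving_neg volume)
  rw [evenPart_apply, evenPart, freeResolvent_smul, freeResolvent_add hm hz hp hg reflected,
    freeResolvent_comp_neg]

theorem oddPart_freeResolvent {m : ℝ} (hm : m ≠ 0) {z : ℂ} (hz : z.im ≠ 0) {g : ℝ × ℝ → ℂ}
    {x : ℝ × ℝ} (hp : x.2 ≠ 0) (hg : MemLp (fun q => g (q, x.2)) 2)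
    (hg' : MemLp (fun q => g (q, -x.2)) 2) :
    oddPart (freeResolvent m z g) x = freeResolvent m z (oddPart g) x := by
  have reflected : MemLp (fun q => ((-1 : ℂ) • (g ∘ Neg.neg)) (q, x.2)) 2 :=
    (hg'.comp_measurePreserving (Measure.measurePreserving_neg volume)).const_smul (-1 : ℂ)
  have difference : oddPart g = (2⁻¹ : ℂ) • (g + (-1 : ℂ) • (g ∘ Neg.neg)) := by
    rw [oddPart, neg_one_smul, sub_eq_add_neg]
  rw [oddPart_apply, difference, freeResolvent_smul, freeResolvent_add hm hz hp hg reflected,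
    freeResolvent_smul, freeResolvent_comp_neg, neg_one_mul, sub_eq_add_neg]

/-! ### The perturbed resolvent -/

theorem recip_Bfun_sub {m : ℝ} (hm : m ≠ 0) (b : OnePoint ℝ) {σ : ℂ} (hσ : σ * σ = 1) {p : ℝ}
    (hp : p ≠ 0) : (recip (Bfun b p) : ℂ) - σ * (Complex.I * m / (2 * |p|)) =
      -(σ * (Complex.I * m / (2 * |p|))) * (1 + σ * (Complex.I * kappa m b p)) := by
  have momentum_ne_zero : ((|p| : ℝ) : ℂ) ≠ 0 := by exact_mod_cast abs_ne_zero.2 hp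
  have mass_ne_zero : (m : ℂ) ≠ 0 := by exact_mod_cast hm
  rw [kappa]
  push_cast
  field_simp
  linear_combination (2 * ((|p| : ℝ) : ℂ) * (recip (Bfun b p) : ℂ)) *
    (Complex.I ^ 2 * hσ + Complex.I_sq)

theorem Gop_Lam_apply {m : ℝ} (hm : 0 < m) (b : OnePoint ℝ) {z : ℂ} (hz : z.im ≠ 0)
    (φ : ℝ → ℂ) {x : ℝ × ℝ} (hp : x.2 ≠ 0) :
    Gop m z (Lam m b z φ) x = -if 0 < x.1 * (Real.sign z.im * x.2 / m) then
      2 * (1 + (Real.sign z.im : ℂ) * (Complex.I * kappa m b x.2))⁻¹ *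
        Complex.exp (Complex.I * (Real.sign z.im : ℂ) * z *
          (x.1 / (Real.sign z.im * x.2 / m) : ℝ)) *
        φ x.2 else 0 := by
  have mass_ne_zero : (m : ℂ) ≠ 0 := by exact_mod_cast hm.ne'
  have momentum_ne_zero : ((|x.2| : ℝ) : ℂ) ≠ 0 := by exact_mod_cast abs_ne_zero.2 hp
  have sign_sq := sign_mul_sign_self hz
  have support : 0 < x.1 * x.2 * z.im ↔ 0 < x.1 * (Real.sign z.im * x.2 / m) := by
    have : x.1 * x.2 * z.im =
        x.1 * (Real.sign z.im * x.2 / m) * (m * (Real.sign z.im * z.im)) := by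
      field_simp
      linear_combination (-x.1) * sign_sq
    rw [this, mul_pos_iff_of_pos_right (mul_pos hm (Real.sign_mul_pos_of_ne_zero _ hz))]
  have sign_sq' : (Real.sign z.im : ℂ) * Real.sign z.im = 1 := by exact_mod_cast sign_sq
  have sign_ne_zero := left_ne_zero_of_mul_eq_one sign_sq'
  have exponent : Complex.I * (Real.sign z.im : ℂ) * z * (x.1 / (Real.sign z.im * x.2 / m) : ℝ) =
      Complex.I * m * z * x.1 / x.2 := by
    push_cast
    field_simp
  have denominator_ne_zero : 1 + (Real.sign z.im : ℂ) * (Complex.I * kappa m b x.2) ≠ 0 := by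
    simpa [mul_left_comm] using one_add_I_mul_ne_zero (Real.sign z.im * kappa m b x.2)
  simp only [Gop, gKer, heaviside, support, Lam,
    recip_Bfun_sub hm.ne' b sign_sq' hp, exponent]
  split_ifs
  · push_cast
    field_simp [denominator_ne_zero]
  · simp

theorem phase_inv_mul_freeResolvent {m : ℝ} (hm : 0 < m) (b : OnePoint ℝ) {z : ℂ}
    (hz : z.im ≠ 0) {g : ℝ × ℝ → ℂ} {x : ℝ × ℝ} (hq : x.1 ≠ 0) (hp : x.2 ≠ 0)
    (hg : MemLp (fun q => g (q, x.2)) 2) :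
    (phase m b x)⁻¹ * freeResolvent m z (phase m b * g) x =
      freeResolvent m z g x + Gop m z (Lam m b z fun p => freeResolvent m z g (0, p)) x := by
  set σ := Real.sign z.im with hσ
  have hc : σ * x.2 / m ≠ 0 := sign_mul_div_ne_zero hm.ne' hz hp
  have sign_mul {s : ℝ} (hs : 0 < s) : Real.sign (σ * s) = σ := by
    rcases hz.lt_or_gt with h | h
    · rw [hσ, Real.sign_of_neg h, Real.sign_of_neg (by linarith)]
    · rw [hσ, Real.sign_of_pos h, Real.sign_of_pos (by linarith)]
  have not_crossing : ∀ᵐ s : ℝ, (shear m (σ * s) x).1 ≠ 0 := by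
    filter_upwards [Measure.ae_ne volume (x.1 / (σ * x.2 / m))] with s hs h
    rw [shear_sign_mul, sub_eq_zero] at h
    exact hs (eq_div_of_mul_eq hc (by rw [mul_comm, h]))
  have jump : ∀ᵐ s : ℝ ∂volume.restrict (Set.Ioi 0),
      Complex.exp (Complex.I * (σ : ℂ) * z * s) *
        ((phase m b x)⁻¹ * (phase m b * g) (shear m (σ * s) x)) =
      Complex.exp (Complex.I * (σ : ℂ) * z * s) *
        ((1 - if x.1 * (x.1 - σ * x.2 / m * s) < 0 then
          2 * (1 + (σ : ℂ) * (Complex.I * kappa m b x.2))⁻¹ else 0) *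
            g (x.1 - σ * x.2 / m * s, x.2)) := by
    filter_upwards [ae_restrict_of_ae not_crossing, ae_restrict_mem measurableSet_Ioi] with s hs hs'
    rw [Pi.mul_apply, ← mul_assoc _ (phase m b _), phase_inv_mul_phase_shear hm b _ hq hp hs,
      scatterCoeff_eq hm, sign_mul hs', mul_ite, mul_zero, shear_sign_mul]
  rw [freeResolvent_eq_setIntegral, mul_left_comm, ← integral_const_mul]
  simp only [mul_left_comm _ (Complex.exp _)]
  rw [integral_congr_ae jump, setIntegral_crossing (re_I_mul_sign_mul_neg hz) hc hg,
    Gop_Lam_apply hm b hz _ hp]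
  simp only [freeResolvent]
  split_ifs <;> ring

theorem mulOdd_inv_freeResolvent_mulOdd {m : ℝ} (hm : 0 < m) (b : OnePoint ℝ) {z : ℂ}
    (hz : z.im ≠ 0) {g : ℝ × ℝ → ℂ} (hg : MemLp g 2) :
    mulOdd (phase m b)⁻¹ (freeResolvent m z (mulOdd (phase m b) g)) =ᵐ[volume] fun x =>
      freeResolvent m z g x +
        Gop m z (Lam m b z (oddProj fun p => freeResolvent m z g (0, p))) x := by
  have hu := isEvenPhase_phase m b
  have hWg := hu.memLp_mulOdd hg
  filter_upwards [ae_fst_ne_zero, ae_snd_ne_zero, ae_memLp_section_snd hg,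
    ae_memLp_section_neg_snd hg, ae_memLp_section_snd hWg, ae_memLp_section_neg_snd hWg,
    ae_memLp_section_snd (memLp_oddPart hg)] with x hq hp section_g section_g' section_Wg
    section_Wg' section_odd
  have boundary : Gop m z (Lam m b z fun p => freeResolvent m z (oddPart g) (0, p)) x =
      Gop m z (Lam m b z (oddProj fun p => freeResolvent m z g (0, p))) x := by
    have : freeResolvent m z (oddPart g) (0, x.2) =
        oddProj (fun p => freeResolvent m z g (0, p)) x.2 := by
      rw [← oddPart_freeResolvent (x := (0, x.2)) hm.ne' hz hp section_g section_g',
        oddPart_apply, oddProj, Prod.neg_mk, neg_zero, one_div]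
    simp only [Gop, Lam, this]
  calc mulOdd (phase m b)⁻¹ (freeResolvent m z (mulOdd (phase m b) g)) x
      = freeResolvent m z (evenPart g) x +
          (phase m b x)⁻¹ * freeResolvent m z (phase m b * oddPart g) x := by
        rw [← evenPart_mulOdd hu.even g, ← oddPart_mulOdd hu.even g,
          ← evenPart_freeResolvent hm.ne' hz hp section_Wg section_Wg',
          ← oddPart_freeResolvent hm.ne' hz hp section_Wg section_Wg']
        rfl
    _ = freeResolvent m z (evenPart g) x + freeResolvent m z (oddPart g) x +
          Gop m z (Lam m b z (oddProj fun p => freeResolvent m z g (0, p))) x := by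
        rw [phase_inv_mul_freeResolvent hm b hz hq hp section_odd, boundary, add_assoc]
    _ = _ := by
        rw [← evenPart_freeResolvent hm.ne' hz hp section_g section_g',
          ← oddPart_freeResolvent hm.ne' hz hp section_g section_g', ← Pi.add_apply,
          evenPart_add_oddPart]

theorem coeFn_laplaceResolvent_perturbedGroup {m : ℝ} (hm : 0 < m) (b : OnePoint ℝ) {z : ℂ}
    (hz : z.im ≠ 0) (g : PhaseL2) :
    (laplaceResolvent (perturbedGroup m b) z g : PhaseL2) =ᵐ[volume] fun x =>
      freeResolvent m z g x +
        Gop m z (Lam m b z (oddProj fun p => freeResolvent m z g (0, p))) x := by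
  have hu := isEvenPhase_phase m b
  have conj : laplaceResolvent (perturbedGroup m b) z g = hu.isometryEquiv.symm
      (laplaceResolvent (freeGroup m) z (hu.isometryEquiv g)) := laplaceResolvent_conj _ z g
  have measurable : Measurable (mulOdd (phase m b) g) :=
    hu.measurable_mulOdd (Lp.stronglyMeasurable g).measurable
  have free := coeFn_laplaceResolvent_freeGroup m hz measurable (hu.coeFn_isometryEquiv g)
  rw [conj]
  exact ((hu.coeFn_isometryEquiv_symm _).trans (mulOdd_congr_ae _ free)).trans
    (mulOdd_inv_freeResolvent_mulOdd hm b hz (Lp.memLp g))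

/-! ### Identification of the generators -/

theorem isTrace_freeResolvent {m : ℝ} (hm : m ≠ 0) {z : ℂ} (hz : z.im ≠ 0) (g : PhaseL2) :
    IsTrace (laplaceResolvent (freeGroup m) z g : PhaseL2)
      fun p => freeResolvent m z g (0, p) := by
  refine ⟨freeResolvent m z g, coeFn_laplaceResolvent_freeGroup m hz
    (Lp.stronglyMeasurable g).measurable .rfl, ?_, ae_of_all _ fun _ => rfl⟩
  filter_upwards [ae_memLp_section (Lp.memLp g), Measure.ae_ne volume (0 : ℝ)] with p hg hp
  exact continuous_freeResolvent hm hz hp hg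

theorem IsTrace.unique {f : ℝ × ℝ → ℂ} {φ ψ : ℝ → ℂ} (hφ : IsTrace f φ) (hψ : IsTrace f ψ) :
    φ =ᵐ[volume] ψ := by
  obtain ⟨F, hF, continuous_F, trace_F⟩ := hφ
  obtain ⟨G, hG, continuous_G, trace_G⟩ := hψ
  filter_upwards [ae_ae_of_ae_swap (hF.symm.trans hG), continuous_F, trace_F, continuous_G,
    trace_G] with p hFG hF hφ hG hψ
  rw [hφ, hψ]
  exact congr_fun ((hF.ae_eq_iff_eq volume hG).1 hFG) 0

theorem Gop_Lam_oddProj_congr_ae (m : ℝ) (b : OnePoint ℝ) (z : ℂ) {φ ψ : ℝ → ℂ}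
    (h : φ =ᵐ[volume] ψ) :
    Gop m z (Lam m b z (oddProj φ)) =ᵐ[volume] Gop m z (Lam m b z (oddProj ψ)) := by
  have h' := (Measure.measurePreserving_neg volume).quasiMeasurePreserving.ae h
  filter_upwards [Measure.quasiMeasurePreserving_snd.ae h,
    Measure.quasiMeasurePreserving_snd.ae h'] with x hx hx'
  simp only [Gop, Lam, oddProj, hx, hx']

theorem mem_graph_L0_iff (m : ℝ) {z : ℂ} (hz : z.im ≠ 0) (f h : PhaseL2) :
    (f, h) ∈ (L0 m).graph ↔ f = laplaceResolvent (freeGroup m) z (h - z • f) := by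
  have hU := isIsometricFlow_freeGroup m
  rw [(isUnitaryGroup_freeGroup m).generator, hU.tendsto_slope_iff_hasDerivAt,
    hU.hasDerivAt_iff_eq_laplaceResolvent hz]

theorem mem_graphLB_iff {m : ℝ} (hm : 0 < m) (b : OnePoint ℝ) {z : ℂ} (hz : z.im ≠ 0)
    (f h : PhaseL2) :
    (f, h) ∈ graphLB m b z ↔ f = laplaceResolvent (perturbedGroup m b) z (h - z • f) := by
  set g := h - z • f
  have hfree : (laplaceResolvent (freeGroup m) z g : PhaseL2) =ᵐ[volume] freeResolvent m z g :=
    coeFn_laplaceResolvent_freeGroup m hz (Lp.stronglyMeasurable g).measurable .rfl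
  have hperturbed := coeFn_laplaceResolvent_perturbedGroup hm b hz g
  have htrace := isTrace_freeResolvent hm.ne' hz g
  constructor
  · rintro ⟨fz, φ, hφ, hf, hg⟩
    have hfz := (mem_graph_L0_iff m hz _ _).1 ((L0 m).mem_graph fz)
    rw [← show g = L0 m fz - z • (fz : PhaseL2) from hg] at hfz
    rw [← hfz] at hfree htrace
    refine Lp.ext ?_
    filter_upwards [hf, hfree, Gop_Lam_oddProj_congr_ae m b z (hφ.unique htrace),
      hperturbed] with x hf hfree hφ hperturbed
    rw [hf, hfree, hφ, hperturbed]
  · intro hf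
    have mem_graph : (laplaceResolvent (freeGroup m) z g,
        g + z • laplaceResolvent (freeGroup m) z g) ∈ (L0 m).graph := by
      rw [mem_graph_L0_iff m hz, add_sub_cancel_right]
    obtain ⟨fz, hfz : (fz : PhaseL2) = _, L0_fz : L0 m fz = _⟩ :=
      (LinearPMap.mem_graph_iff _).1 mem_graph
    refine ⟨fz, fun p => freeResolvent m z g (0, p), by rw [hfz]; exact htrace, ?_, ?_⟩
    · rw [← hf] at hperturbed
      rw [hfz]
      filter_upwards [hperturbed, hfree] with x hperturbed hfree
      rw [hperturbed, hfree]
    · rw [L0_fz, hfz, add_sub_cancel_right]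

theorem isUnitaryGroup_perturbedGroup {m : ℝ} (hm : 0 < m) (b : OnePoint ℝ) {z : ℂ}
    (hz : z.im ≠ 0) : IsUnitaryGroup (LB m b z) (perturbedGroup m b) := by
  have hU := isIsometricFlow_perturbedGroup m b
  refine ⟨hU.map_zero, hU.map_add, hU.continuous, fun f h => ?_⟩
  rw [LB_graph hm.ne' b hz, hU.tendsto_slope_iff_hasDerivAt,
    hU.hasDerivAt_iff_eq_laplaceResolvent hz, mem_graphLB_iff hm b hz]

theorem IsUnitaryGroup.unique {A : PhaseL2 →ₗ.[ℂ] PhaseL2} {U V : ℝ → PhaseL2 ≃ₗᵢ[ℂ] PhaseL2}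
    (hU : IsUnitaryGroup A U) (hV : IsUnitaryGroup A V) : U = V := by
  refine hU.isIsometricFlow.unique hV.isIsometricFlow fun f g hfg => ?_
  obtain ⟨h, rfl⟩ : ∃ h, g = -Complex.I • h := ⟨Complex.I • g, by simp [smul_smul]⟩
  rw [← hV.isIsometricFlow.tendsto_slope_iff_hasDerivAt, ← hV.generator, hU.generator,
    hU.isIsometricFlow.tendsto_slope_iff_hasDerivAt]
  exact hfg

end

theorem proposition2p3 (m : ℝ) (hm : 0 < m) (b : OnePoint ℝ) (hb : b ≠ ((0 : ℝ) : OnePoint ℝ))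
    (z : ℂ) (hz : z.im ≠ 0) :
    (∃ U₀, IsUnitaryGroup (L0 m) U₀) ∧
    (∃ U, IsUnitaryGroup (LB m b z) U) ∧
    ∀ U₀ U, IsUnitaryGroup (L0 m) U₀ → IsUnitaryGroup (LB m b z) U →
      ∀ (t : ℝ) (f : PhaseL2),
        (U₀ t f =ᵐ[volume] freeFlow m t f) ∧
        (U t f =ᵐ[volume] fun x =>
          freeFlow m t f x -
            ((heaviside (t * x.1 * x.2) * heaviside (|x.2 * t| / m - |x.1|) : ℝ) : ℂ) /
              (1 + (Real.sign t : ℂ) *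
                (2 * Complex.I * |x.2| / m * (recip (Bfun b x.2) : ℂ))) *
              freeFlow m t (fOdd f) x) := by
  have h₀ := isUnitaryGroup_freeGroup m
  have hB := isUnitaryGroup_perturbedGroup hm b hz
  refine ⟨⟨_, h₀⟩, ⟨_, hB⟩, fun U₀ U hU₀ hU t f => ⟨?_, ?_⟩⟩
  · rw [hU₀.unique h₀]
    exact coeFn_freeGroup m t f
  · rw [hU.unique hB]
    exact coeFn_perturbedGroup hm b t f
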